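/- **Notation.** $C_p(\mathbb R)$ is the set of nonconstant periodic continuous functions $g:\mathbb R\to\mathbb R$; $T_g>0$ is the least positive period of $g$ and $A_g=\max g-\min g$. **The theory $\mathcal M^*(PI)$.** A model consists of a set $\mathbb S$ of sounds, a binary relation $*$ on $\mathbb S$ ("lower in pitch"), a relation $\cong$ between intervals, functions $\iota:\mathbb S\to\mathbb R^+$ (intensity) and $\Gamma:\mathbb S\to C_p(\mathbb R)$ (timbre), and a base: sounds $x_0*y_0$ and reals $\lambda>1$, $f_0>0$, $\iota_0>0$. Here $x\sim y$ means that neither $x*y$ nor $y*x$, and the interval $[a,b]$ is the pair $(\tilde a,\tilde b)$ of $\sim$-classes. The axioms are: 1. $*$ is irreflexive and transitive; $x*y$ for some $x,y$; if $x*y$, no $z$ satisfies $x\sim z\sim y$; for every $x$ there are $a,b$ with $a*x*b$; if $x*y$ then $x*a*y$ for some $a$. 2. $\cong$ is reflexive and transitive; for all $x,y,a$ there is $b$, unique up to $\sim$, with $[x,y]\cong[a,b]$. 3. If $a*b$, then $[a,b]\cong[c,d]$ implies $c*d$, and $[a,b]\cong[c,d]$ iff $[b,a]\cong[d,c]$.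 4. If $a*b*c$: $[a,b]\cong[a',b']$ and $[b,c]\cong[b',c']$ imply $[a,c]\cong[a',c']$; and $[a,b]\cong[b',a']$ and $[b,c]\cong[c',b']$ imply $[a,c]\cong[c',a']$. 5. (Dedekind) If $\{P,Q\}$ is a partition of $\mathbb S$ into two nonempty sets such that no sound of one is lower than a sound of the other, there is a sound $\theta$ such that all sounds lower than $\theta$ lie in one of the two sets and all sounds higher than $\theta$ lie in the other. By 1-5 there is exactly one function $[a,b]\mapsto|[a,b]|\in\mathbb R^+$ (the measure) with $|[x_0,y_0]|=\lambda$, with $|[a,b]|<1$, $=1$, $>1$ iff $b*a$, $a\sim b$, $a*b$ respectively, with $|I|=|J|$ iff $I\cong J$, with $|[a,c]|=|[a,b]|\,|[b,c]|$, and onto $\mathbb R^+$. The frequency is $f(x)=f_0\,|[x_0,x]|$. 6. For every $c>0$ there is $\iota':\mathbb S\to\mathbb R^+$ with $\iota'(x_0)=c$ that takes every positive value on every $\sim$-class; $\iota$ is such a function for $c=\iota_0$. 7. $T_{\Gamma(x)}=f(x)$ and $A_{\Gamma(x)}=\iota(x)$ for all $x$; $\Gamma$ is injective and maps onto $C_p(\mathbb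 R)$. **The theory $\mathcal M^*(PIT)$** has two more primitive notions, a relation $\simeq$ on $\mathbb S$ (equitonal) and a property of intervals (harmonic). Write $m=s^*$ if $m$ is a $*$-minimal element of $\{x: s\simeq x,\ s*x\}$; the intervals $[s,s^*]$ are called octaves. Let $H$ be the set of measures of harmonic intervals, $\varepsilon=\inf\{r\in H:r>1\}$ (the semitone), and $\hat s$ the $\simeq$-class of $s$. The further axioms are: 8. $x\sim y$ implies $x\simeq y$; $x\simeq z$ and $y\simeq z$ imply $x\simeq y$; $y_0=x_0^*$ and $\lambda=2$; every interval congruent to an octave is an octave. 9. If $a*b$, $[a,b]$ is harmonic and $[a,b]\cong[c,d]$, then $[c,d]$ is harmonic; the conversion $[b,a]$ of a harmonic $[a,b]$ with $a\not\sim b$ is harmonic. 10. If $[a,b]$ and $[c,d]$ are harmonic, $a*b$ and $c\not\sim d$, then every $[x,y]$ with $[x,z]\cong[a,b]$ and $[z,y]\cong[c,d]$ for some $z$ is harmonic. 11. There is $\alpha>1$ such that no $\beta\in H$ satisfies $1<\beta<\alpha$. 12. There are a note $\hat s$ and numbers $r_1,\dots,r_7\in H\cap(1,\infty)$ with inverses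 in $H$ and $\prod_i r_i=2$ (a heptatonic compatible scale with descendent steps $r'_i=r_{8-i}^{-1}$) such that: one of its modes $\{r_i\}$, $\{r'_i\}$ is contained in $\{\varepsilon^k,\varepsilon^{k+1}\}$ for some integer $k$; $r_7=\varepsilon$ and $r'_7\ne\varepsilon^{-1}$; two tetrachords (triples of adjacent ascendent, or of adjacent descendent, steps) are equal as triples while the sets of the four successive notes they span meet at most in $\hat s$; and there is a major triad $(x,y,z)$, that is $x*y*z$ with $[x,y],[y,z],[x,z]$ harmonic, $|[x,y]|=\varepsilon|[y,z]|$ and $|[x,z]|=\varepsilon\sqrt2$, such that the notes reached from $\hat s$ by the steps $|[x,y]|,|[y,z]|$ are among the notes reached from $\hat s$ by the steps $r_1,\dots,r_7$. **Theorem.** The theory $\mathcal M^*(PI)$ is categorical: (i) For all $\lambda>1$, $f_0>0$, $\iota_0>0$ there is a model of $\mathcal M^*(PI)$ with these constants. (ii) If $\mathcal M_1,\mathcal M_2$ are models of $\mathcal M^*(PI)$, then the bijection $\Phi=\Gamma_2^{-1}\circ\Gamma_1:\mathbb S_1\to\mathbb S_2$ is an isomorphism: $x*_1y\iff\Phi(x)*_2\Phi(y)$,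 and $[a,b]\cong_1[c,d]\iff[\Phi(a),\Phi(b)]\cong_2[\Phi(c),\Phi(d)]$; it also preserves timbre, intensity and frequency. Likewise $\mathcal M^*(PIT)$ is categorical: for all $f_0,\iota_0>0$ it has a model with these constants, and for any two models the map $\Gamma_2^{-1}\circ\Gamma_1$ is an isomorphism as in (ii) that moreover preserves $\simeq$ and harmonicity of intervals in both directions. -/

import Mathlib

universe u v w

noncomputable section

namespace Music

/-! ### Nonconstant periodic continuous functions -/

/-- The set `C_p(ℝ)` of all nonconstant periodic continuous real functions. -/
def Cp : Type :=
  {g : ℝ → ℝ // Continuous g ∧ (∃ T : ℝ, 0 < T ∧ Function.Periodic g T) ∧ ∃ x y, g x ≠ g y}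

/-- The period of `g`: the least positive period (the infimum is attained on `C_p(ℝ)`). -/
def Cp.period (g : Cp) : ℝ := sInf {T : ℝ | 0 < T ∧ Function.Periodic g.1 T}

/-- The amplitude of `g`: the diameter of its (bounded) range. -/
def Cp.amplitude (g : Cp) : ℝ := Metric.diam (Set.range g.1)

/-! ### Pitch and intervals -/

/-- `x` and `y` are identical in pitch: none is lower than the other. -/
def Identical {S : Type u} (lower : S → S → Prop) (x y : S) : Prop :=
  ¬ (lower x y ∨ lower y x)

/-- An interpretation of the concepts of the theory: sounds, lower-pitched, congruence of
intervals (an interval is a pair of pitch classes), the intensity and the timbre,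
together with the constants that are given once and for all: the base interval `[x₀, y₀]` with
its measure `lam`, and the frequency `f₀` and the intensity `i₀` of the base sound `x₀`. -/
structure Interpretation where
  Sound : Type u
  lower : Sound → Sound → Prop
  cong : Quot (Identical lower) × Quot (Identical lower) →
    Quot (Identical lower) × Quot (Identical lower) → Prop
  x₀ : Sound
  y₀ : Sound
  lam : ℝ
  f₀ : ℝ
  i₀ : ℝ
  intensity : Sound → ℝ
  timbre : Sound → Cp

namespace Interpretation

variable (M : Interpretation.{u})

/-- Identity in pitch, `x ∼ y`. -/
def ident (x y : M.Sound) : Prop := Identical M.lower x y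

/-- The set `𝕀 = (𝕊/∼) × (𝕊/∼)` of all intervals. -/
abbrev Interval : Type u := Quot (Identical M.lower) × Quot (Identical M.lower)

/-- The interval `[a, b]`. -/
def interval (a b : M.Sound) : M.Interval := (Quot.mk _ a, Quot.mk _ b)

/-- `{P, Q}` is a cut: a partition of the sounds into two nonempty sets such that no sound of one
of them is lower than a sound of the other. -/
def IsCut (P Q : Set M.Sound) : Prop :=
  P.Nonempty ∧ Q.Nonempty ∧ P ∪ Q = Set.univ ∧ P ∩ Q = ∅ ∧
    ((∀ p ∈ P, ∀ q ∈ Q, ¬ M.lower p q) ∨ (∀ p ∈ P, ∀ q ∈ Q, ¬ M.lower q p))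

/-- `θ` is a cut sound of `{P, Q}`: every sound lower than `θ` is in one of the two sets, and every
sound higher than `θ` is in the other one. -/
def IsCutSound (P Q : Set M.Sound) (θ : M.Sound) : Prop :=
  ((∀ x, M.lower x θ → x ∈ P) ∧ (∀ x, M.lower θ x → x ∈ Q)) ∨
    ((∀ x, M.lower x θ → x ∈ Q) ∧ (∀ x, M.lower θ x → x ∈ P))

/-- The axioms about pitch. -/
structure PitchAxioms : Prop where
  irrefl : ∀ x, ¬ M.lower x x
  trans : ∀ x y z, M.lower x y → M.lower y z → M.lower x z
  existence : ∃ x y, M.lower x y ∨ M.lower y x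
  separation : ∀ x y z, M.lower x y → ¬ (M.ident x z ∧ M.ident y z)
  between_some : ∀ x, ∃ a b, M.lower a x ∧ M.lower x b
  between_two : ∀ x y, M.lower x y → ∃ a, M.lower x a ∧ M.lower a y

/-- The axioms about intervals, and Dedekind's continuity axiom. -/
structure IntervalAxioms : Prop where
  cong_refl : ∀ I, M.cong I I
  cong_trans : ∀ I J K, M.cong I J → M.cong J K → M.cong I K
  motion : ∀ x y a, ∃ b, M.cong (M.interval x y) (M.interval a b) ∧
    ∀ b', M.cong (M.interval x y) (M.interval a b') → M.ident b b'
  regularity_lower : ∀ a b c d, M.lower a b →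
    M.cong (M.interval a b) (M.interval c d) → M.lower c d
  regularity_conversion : ∀ a b c d, M.lower a b →
    (M.cong (M.interval a b) (M.interval c d) ↔ M.cong (M.interval b a) (M.interval d c))
  addition : ∀ a b c a' b' c', M.lower a b → M.lower b c →
    M.cong (M.interval a b) (M.interval a' b') → M.cong (M.interval b c) (M.interval b' c') →
    M.cong (M.interval a c) (M.interval a' c')
  addition_conversion : ∀ a b c a' b' c', M.lower a b → M.lower b c →
    M.cong (M.interval a b) (M.interval b' a') → M.cong (M.interval b c) (M.interval c' b') →
    M.cong (M.interval a c) (M.interval c' a')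
  dedekind : ∀ P Q, M.IsCut P Q → ∃ θ, M.IsCutSound P Q θ

/-! ### Measure of intervals, frequency, intensity -/

/-- `μ` is a measure of intervals with value `lam` on the base interval. On an interpretation
that satisfies the axioms above there is exactly one; it is also compatible with the order of
free intervals and with dyadic multiples, which is a consequence of the clauses listed here. -/
structure IsMeasure (μ : M.Interval → ℝ) : Prop where
  pos : ∀ I, 0 < μ I
  base : μ (M.interval M.x₀ M.y₀) = M.lam
  lt_one_iff : ∀ a b, μ (M.interval a b) < 1 ↔ M.lower b a
  eq_one_iff : ∀ a b, μ (M.interval a b) = 1 ↔ M.ident a b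
  one_lt_iff : ∀ a b, 1 < μ (M.interval a b) ↔ M.lower a b
  eq_iff : ∀ I J, μ I = μ J ↔ M.cong I J
  mul : ∀ a b c, μ (M.interval a c) = μ (M.interval a b) * μ (M.interval b c)
  surj : ∀ r : ℝ, 0 < r → ∃ I, μ I = r ∧ ∀ J, μ J = r → M.cong I J

/-- The measure `|I|` of an interval: the unique `μ` with `M.IsMeasure μ`. -/
def measure : M.Interval → ℝ := Classical.epsilon M.IsMeasure

/-- The frequency of sounds in base `(x₀, f₀)`: the unique function with value `f₀` at `x₀` such
that `|[x, y]|` is the quotient of the frequencies of `y` and `x`. -/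
def frequency (x : M.Sound) : ℝ := M.f₀ * M.measure (M.interval M.x₀ x)

/-- `ι` is an intensity of sounds in base `(x₀, c)`. -/
def IsIntensity (c : ℝ) (ι : M.Sound → ℝ) : Prop :=
  (∀ x, 0 < ι x) ∧ ι M.x₀ = c ∧ ∀ r : ℝ, 0 < r → ∀ s, ∃ x, M.ident x s ∧ ι x = r

/-! ### The theories `M(PI)` and `M*(PI)` -/

/-- `M` is a model of `M(PI)`. -/
structure IsModelPI : Prop where
  pitch : M.PitchAxioms
  intervals : M.IntervalAxioms
  base_lower : M.lower M.x₀ M.y₀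
  one_lt_lam : 1 < M.lam
  f₀_pos : 0 < M.f₀
  i₀_pos : 0 < M.i₀
  loudness : ∀ c : ℝ, 0 < c → ∃ ι, M.IsIntensity c ι
  intensity_spec : M.IsIntensity M.i₀ M.intensity
  colour : ∀ x, (M.timbre x).period = M.frequency x ∧ (M.timbre x).amplitude = M.intensity x
  extensionality : ∀ x y, M.timbre x = M.timbre y → x = y

/-- `M` is a model of `M*(PI)`: moreover the timbre is onto `C_p(ℝ)`. -/
structure IsModelPIStar : Prop extends M.IsModelPI where
  timbre_onto : ∀ g : Cp, ∃ x, M.timbre x = g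

variable {M}

/-- In a model of `M*(PI)` the timbre is a bijection from the sounds onto `C_p(ℝ)`. -/
def IsModelPIStar.timbreEquiv (h : M.IsModelPIStar) : M.Sound ≃ Cp :=
  Equiv.ofBijective M.timbre ⟨fun x y => h.extensionality x y, h.timbre_onto⟩

end Interpretation

/-- The bijection `φ` is an isomorphism: it preserves pitch order, congruence of intervals,
timbre, intensity and frequency. -/
structure IsIso (M : Interpretation.{u}) (N : Interpretation.{v}) (φ : M.Sound ≃ N.Sound) :
    Prop where
  lower_iff : ∀ x y, M.lower x y ↔ N.lower (φ x) (φ y)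
  cong_iff : ∀ a b c d, M.cong (M.interval a b) (M.interval c d) ↔
    N.cong (N.interval (φ a) (φ b)) (N.interval (φ c) (φ d))
  timbre_eq : ∀ x, N.timbre (φ x) = M.timbre x
  intensity_eq : ∀ x, N.intensity (φ x) = M.intensity x
  frequency_eq : ∀ x, N.frequency (φ x) = M.frequency x

/-! ### Tone music: the theory `M*(PIT)` -/

/-- An interpretation together with the two further primitive concepts: equitonal sounds and
harmonic intervals. -/
structure ToneInterpretation extends Interpretation.{u} where
  equitonal : Sound → Sound → Prop
  harmonic : toInterpretation.Interval → Prop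

namespace ToneInterpretation

variable (M : ToneInterpretation.{u})

/-- `m` is (a choice of) `s*`: a minimal element, with respect to pitch, of the set of sounds
that are equitonal to `s` and higher than `s`. -/
def IsStar (s m : M.Sound) : Prop :=
  M.equitonal s m ∧ M.lower s m ∧ ∀ x, M.equitonal s x → M.lower s x → ¬ M.lower x m

/-- `I` is an octave interval, `I = [s, s*]`. -/
def IsOctave (I : M.Interval) : Prop := ∃ s m, M.IsStar s m ∧ I = M.interval s m

/-- `|𝕀*|`: the measures of the harmonic intervals. -/
def harmonicMeasures : Set ℝ := {r | ∃ I, M.harmonic I ∧ M.measure I = r}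

/-- The semitone `ε`: the least measure of a harmonic interval greater than unit. -/
def semitone : ℝ := sInf {r | r ∈ M.harmonicMeasures ∧ 1 < r}

/-- The equivalence classes `ŝ` of equitonal sounds. -/
abbrev Note : Type u := Quot M.equitonal

/-- The class `ŝ`. -/
def note (s : M.Sound) : M.Note := Quot.mk _ s

/-- `ν` is the note that is reached from the note `κ` after the first `i` of the steps `L`. -/
def IsDegree (κ : M.Note) (L : List ℝ) (i : ℕ) (ν : M.Note) : Prop :=
  ∃ s t, M.note s = κ ∧ M.frequency t = M.frequency s * (L.take i).prod ∧ M.note t = ν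

/-- The notes reached from `κ` after `i, …, j` of the steps `L`. -/
def degrees (κ : M.Note) (L : List ℝ) (i j : ℕ) : Set M.Note :=
  {ν | ∃ k, i ≤ k ∧ k ≤ j ∧ M.IsDegree κ L k ν}

/-- The components set of `(κ, L)`: all notes reached from `κ` by the steps `L`. -/
def components (κ : M.Note) (L : List ℝ) : Set M.Note := M.degrees κ L 0 L.length

/-- A scale: a tonic, and the ascendent and the descendent tuple of measures of harmonic
intervals, which make up an octave upwards and an octave downwards. -/
structure Scale where
  tonic : M.Note
  asc : List ℝ
  desc : List ℝ
  asc_mem : ∀ r ∈ asc, r ∈ M.harmonicMeasures ∧ 1 < r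
  desc_mem : ∀ r ∈ desc, r ∈ M.harmonicMeasures ∧ r < 1
  asc_prod : asc.prod = 2
  desc_prod : desc.prod = 1 / 2

/-- The mode with elements `L` is maximally even. -/
def MaximallyEvenMode (L : List ℝ) : Prop :=
  ∃ k : ℤ, ∀ r ∈ L, r = M.semitone ^ k ∨ r = M.semitone ^ (k + 1)

namespace Scale

variable {M} (S : M.Scale)

def Heptatonic : Prop := S.asc.length = 7 ∧ S.desc.length = 7

/-- The descendent tuple consists of the inverses of the ascendent one in reversed order. -/
def Compatible : Prop := S.desc = (S.asc.map fun r => r⁻¹).reverse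

/-- One of the modes of the scale is maximally even (for a compatible scale then both are). -/
def HasMaximallyEvenMode : Prop := M.MaximallyEvenMode S.asc ∨ M.MaximallyEvenMode S.desc

/-- The ascendent module has the sensible: the last ascendent step is a semitone. -/
def AscSensible : Prop := S.asc.getLast? = some M.semitone

/-- The descendent module has the sensible: the last descendent step is a semitone down. -/
def DescSensible : Prop := S.desc.getLast? = some M.semitone⁻¹

/-- `τ` is a tetrachord of the scale, i.e. a triple of adjacent ascendent or of adjacent descendent
steps, and `C` is the set of the four degrees of this tetrachord. -/
def IsTetrachord (τ : List ℝ) (C : Set M.Note) : Prop :=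
  (∃ j, j + 3 ≤ S.asc.length ∧ τ = (S.asc.drop j).take 3 ∧
      C = M.degrees S.tonic S.asc j (j + 3)) ∨
    (∃ j, j + 3 ≤ S.desc.length ∧ τ = (S.desc.drop j).take 3 ∧
      C = M.degrees S.tonic S.desc j (j + 3))

/-- There are two equal tetrachords whose degrees have at most the tonic in common. -/
def HasDisjointEqualTetrachords : Prop :=
  ∃ τ C D, S.IsTetrachord τ C ∧ S.IsTetrachord τ D ∧ C ∩ D ⊆ {S.tonic}

end Scale

/-- The interval `[x, y]` of a pair of sounds `x`, `y` is a dyad. -/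
def IsDyad (x y : M.Sound) : Prop := M.lower x y ∧ M.harmonic (M.interval x y)

/-- A dyad is perfect if it is a semitone greater than half an octave, whose measure is `√2`. -/
def IsPerfectDyad (x y : M.Sound) : Prop :=
  M.IsDyad x y ∧ M.measure (M.interval x y) = M.semitone * √2

/-- `(x, y, z)` is a major triad. -/
def IsMajorTriad (x y z : M.Sound) : Prop :=
  M.IsDyad x y ∧ M.IsDyad y z ∧
    M.measure (M.interval x y) = M.semitone * M.measure (M.interval y z) ∧ M.IsPerfectDyad x z

/-- The triad `(x, y, z)` is (ascendently) scale-based on the tonic of `S`. -/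
def ScaleBasedOnTonic (S : M.Scale) (x y z : M.Sound) : Prop :=
  M.components S.tonic [M.measure (M.interval x y), M.measure (M.interval y z)] ⊆
    M.components S.tonic S.asc

/-- The axioms of tone music. -/
structure ToneAxioms : Prop where
  tonality_ident : ∀ x y, M.ident x y → M.equitonal x y
  tonality_euclid : ∀ x y z, M.equitonal x z → M.equitonal y z → M.equitonal x y
  /-- The base interval is an octave and has measure `2`. -/
  base_octave : M.IsStar M.x₀ M.y₀
  lam_eq_two : M.lam = 2
  uniformity : ∀ s m, M.IsStar s m → ∀ I, M.cong I (M.interval s m) → M.IsOctave I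
  harmony_cong : ∀ a b c d, M.lower a b → M.cong (M.interval a b) (M.interval c d) →
    M.harmonic (M.interval a b) → M.harmonic (M.interval c d)
  harmony_conversion : ∀ a b, ¬ M.ident a b → M.harmonic (M.interval a b) →
    M.harmonic (M.interval b a)
  /-- The sum of the classes of two harmonic intervals `[a, b]` greater than unit and `[c, d]` greater or
  less than unit is a class of harmonic intervals. It consists of the `[x, y]` such that
  `[x, z]` is congruent to `[a, b]` and `[z, y]` to `[c, d]` for some `z`. -/
  harmony_sum : ∀ a b c d, M.harmonic (M.interval a b) → M.harmonic (M.interval c d) →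
    M.lower a b → (M.lower c d ∨ M.lower d c) →
    ∀ x z y, M.cong (M.interval x z) (M.interval a b) → M.cong (M.interval z y) (M.interval c d) →
      M.harmonic (M.interval x y)
  diatonicism : ∃ α : ℝ, 1 < α ∧ ∀ β : ℝ, 1 < β → ¬ (β < α ∧ β ∈ M.harmonicMeasures)
  gamme : ∃ S : M.Scale, S.Heptatonic ∧ S.Compatible ∧ S.HasMaximallyEvenMode ∧
    S.AscSensible ∧ ¬ S.DescSensible ∧ S.HasDisjointEqualTetrachords ∧
    ∃ x y z, M.IsMajorTriad x y z ∧ M.ScaleBasedOnTonic S x y z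

/-- `M` is a model of `M*(PIT)`. -/
structure IsModelPITStar : Prop where
  pi : M.toInterpretation.IsModelPIStar
  tone : M.ToneAxioms

end ToneInterpretation

/-- The bijection `φ` is an isomorphism that moreover preserves tonality and harmony. -/
structure IsToneIso (M : ToneInterpretation.{u}) (N : ToneInterpretation.{v})
    (φ : M.Sound ≃ N.Sound) : Prop where
  iso : IsIso M.toInterpretation N.toInterpretation φ
  equitonal_iff : ∀ x y, M.equitonal x y ↔ N.equitonal (φ x) (φ y)
  harmonic_iff : ∀ a b, M.harmonic (M.interval a b) ↔ N.harmonic (N.interval (φ a) (φ b))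

end Music

end

/-! Every notion of the theory is determined by the frequency and the intensity of sounds, and both
are read off the timbre as period and amplitude. As the timbre is a bijection onto `Cp`, sounds of
two models with the same timbre correspond, and the correspondence is an isomorphism once order and
congruence are expressed by frequencies: lower means smaller frequency, congruent means equal
quotients (`IsModelPI.lower_iff`, `IsModelPI.cong_iff`).

This needs a measure to exist, since `measure` is only a choice. Pitch classes form a dense complete
line; congruence makes its translations a commutative ordered group, which is the real line
(`LineCongruence.exists_coordinate`). The exponential of a rescaled coordinate gives the measure.
Conversely `Cp` itself, with period as frequency and amplitude as intensity, is a model. There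
`measure` must be identified, which rests on its uniqueness (`measure_eq_div_of_coordinate`).

In tone music, equitonal means that frequencies differ by a power of 2, and harmonic measures form a
discrete group, the powers of the semitone ε. The scale axiom fixes ε: two equal tetrachords and one
further step give an octave of 9, 10, 11 or 12 semitones, and the major triad makes this number
divisible by 4. So ε ^ 12 = 2 (`semitone_pow_twelve`). Twelve-tone equal temperament with the major
scale is a model. -/

noncomputable section

namespace Music

/-! ### One-dimensional congruence geometry -/

/-- A congruence of pairs of points of a linear order that is stable under motions, respects the
order, and satisfies the crossed addition law. -/
structure LineCongruence (P : Type u) [LinearOrder P] (C : P → P → P → P → Prop) : Prop where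
  refl : ∀ a b, C a b a b
  trans : ∀ {a b c d e f}, C a b c d → C c d e f → C a b e f
  motion : ∀ x y a, ∃ b, C x y a b ∧ ∀ b', C x y a b' → b = b'
  lt_of_lt : ∀ {a b c d}, a < b → C a b c d → c < d
  conversion : ∀ {a b c d}, a < b → (C a b c d ↔ C b a d c)
  crossed_add : ∀ {a b c a' b' c'}, a < b → b < c → C a b b' a' → C b c c' b' → C a c c' a'

namespace LineCongruence

variable {P : Type u} [LinearOrder P] {C : P → P → P → P → Prop}

lemma unique (h : LineCongruence P C) {x y a b b' : P} (h1 : C x y a b) (h2 : C x y a b') :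
    b = b' := by
  obtain ⟨z, -, hz⟩ := h.motion x y a
  rw [← hz _ h1, ← hz _ h2]

lemma symm (h : LineCongruence P C) {a b c d : P} (h1 : C a b c d) : C c d a b := by
  obtain ⟨z, hz, -⟩ := h.motion c d a
  have : b = z := h.unique (h.refl a b) (h.trans h1 hz)
  rwa [← this] at hz

lemma eq_of_eq (h : LineCongruence P C) {a c d : P} (h1 : C a a c d) : c = d := by
  rcases lt_trichotomy c d with hl | hl | hl
  · exact absurd (h.lt_of_lt hl (h.symm h1)) (lt_irrefl _)
  · exact hl
  · exact absurd (h.lt_of_lt hl ((h.conversion hl).2 (h.symm h1))) (lt_irrefl _)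

lemma unit (h : LineCongruence P C) (a c : P) : C a a c c := by
  obtain ⟨z, hz, -⟩ := h.motion a a c
  have := h.eq_of_eq hz
  rwa [← this] at hz

lemma convert (h : LineCongruence P C) {a b c d : P} (h1 : C a b c d) : C b a d c := by
  rcases lt_trichotomy a b with hl | hl | hl
  · exact (h.conversion hl).1 h1
  · subst hl
    have := h.eq_of_eq h1
    subst this
    exact h1
  · exact (h.conversion hl).2 h1

/-- Carry `[a, c]` to `[b, e]`. Going from `a` to `b` to `e` uses the same two steps as going from
`a` to `c` to `d`, in the opposite order, so the crossed addition law gives `e = d`. -/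
lemma alternate_of_lt (h : LineCongruence P C) {a b c d : P} (hab : a < b) (hac : a < c)
    (h1 : C a b c d) : C a c b d := by
  obtain ⟨e, he, -⟩ := h.motion a c b
  have h2 : C a e a d := h.crossed_add hab (h.lt_of_lt hac he) h1 (h.symm he)
  have : e = d := h.unique (h.refl a e) h2
  rwa [← this]

lemma alternate_of_lt_left (h : LineCongruence P C) {a b c d : P} (hab : a < b)
    (h1 : C a b c d) : C a c b d := by
  rcases lt_trichotomy a c with hl | hl | hl
  · exact h.alternate_of_lt hab hl h1
  · subst hl
    have := h.unique (h.refl a b) h1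
    subst this
    exact h.unit a b
  · exact h.convert (h.alternate_of_lt (h.lt_of_lt hab h1) hl (h.symm h1))

lemma alternate (h : LineCongruence P C) {a b c d : P} (h1 : C a b c d) : C a c b d := by
  rcases lt_trichotomy a b with hl | hl | hl
  · exact h.alternate_of_lt_left hl h1
  · subst hl
    have := h.eq_of_eq h1
    subst this
    exact h.refl a c
  · exact h.symm (h.alternate_of_lt_left hl (h.convert h1))

/-- After alternation the two hypotheses say that `[a, a']`, `[b, b']` and `[c, c']` are congruent,
so transitivity suffices. -/
lemma add (h : LineCongruence P C) {a b c a' b' c' : P} (h1 : C a b a' b') (h2 : C b c b' c') :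
    C a c a' c' :=
  h.alternate (h.trans (h.alternate h1) (h.alternate h2))

/-- The translation that carries `x` to `y`. -/
def translate (h : LineCongruence P C) (x y a : P) : P := (h.motion x y a).choose

lemma translate_spec (h : LineCongruence P C) (x y a : P) : C x y a (h.translate x y a) :=
  (h.motion x y a).choose_spec.1

lemma translate_eq (h : LineCongruence P C) {x y a b : P} (h1 : C x y a b) :
    h.translate x y a = b :=
  h.unique (h.translate_spec x y a) h1

/-- Addition of points with respect to an origin. -/
abbrev addCommGroup (h : LineCongruence P C) (o : P) : AddCommGroup P where
  zero := o
  add p q := h.translate o q p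
  neg p := h.translate p o o
  add_assoc p q s := by
    refine (h.translate_eq (a := p) (x := o) ?_).symm
    refine h.add (h.translate_spec o q p) ?_
    exact h.trans (h.symm (h.translate_spec o s q)) (h.translate_spec o s _)
  zero_add q := h.translate_eq (h.refl o q)
  add_zero p := h.translate_eq (h.unit o p)
  neg_add_cancel p := h.translate_eq (h.convert (h.translate_spec p o o))
  -- Commutativity of the group is exactly the alternation law.
  add_comm p q := h.translate_eq (h.alternate (h.translate_spec o p q))
  nsmul := @nsmulRec _ ⟨o⟩ ⟨fun p q => h.translate o q p⟩
  zsmul := @zsmulRec _ ⟨o⟩ ⟨fun p q => h.translate o q p⟩ ⟨fun p => h.translate p o o⟩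
    (@nsmulRec _ ⟨o⟩ ⟨fun p q => h.translate o q p⟩)

end LineCongruence

/-- A densely ordered abelian group in which bounded sets have suprema is the real line. -/
lemma exists_strictMono_surjective_real {G : Type u} [AddCommGroup G] [LinearOrder G]
    [IsOrderedAddMonoid G] [DenselyOrdered G] [Nontrivial G]
    (hsup : ∀ B : Set G, B.Nonempty → BddAbove B → ∃ s, IsLUB B s) :
    ∃ f : G →+ ℝ, StrictMono f ∧ Function.Surjective f := by
  -- If all multiples of `x` were bounded, with supremum `s`, some `n • x` would exceed `s - x`, and
  -- then `(n + 1) • x` would exceed `s`.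
  have : Archimedean G := by
    refine ⟨fun y x hx => ?_⟩
    by_contra! hy
    obtain ⟨s, hs⟩ := hsup (Set.range fun n : ℕ => n • x) ⟨_, 0, rfl⟩
      ⟨y, by rintro _ ⟨n, rfl⟩; exact (hy n).le⟩
    obtain ⟨_, ⟨n, rfl⟩, hn, -⟩ := hs.exists_between (sub_lt_self s hx)
    have h1 : (n + 1) • x ≤ s := hs.1 ⟨n + 1, rfl⟩
    rw [succ_nsmul] at h1
    exact absurd (sub_lt_iff_lt_add.1 hn) (not_lt.2 h1)
  obtain ⟨f, hf⟩ := Archimedean.exists_orderAddMonoidHom_real_injective G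
  have hmono : StrictMono f := (OrderHomClass.mono f).strictMono_of_injective hf
  refine ⟨f, hmono, fun r => ?_⟩
  -- A nontrivial subgroup of the reals is dense unless it has a least positive element, which the
  -- dense order of `G` excludes.
  have hdense : Dense (Set.range f) := by
    have := AddSubgroup.dense_of_no_min (AddMonoidHom.range (f : G →+ ℝ)) ?_ ?_
    · simpa using this
    · intro hbot
      obtain ⟨p, hp⟩ := exists_ne (0 : G)
      have h1 : f p ∈ AddMonoidHom.range (f : G →+ ℝ) := ⟨p, rfl⟩
      rw [hbot, AddSubgroup.mem_bot] at h1
      exact hp (hf (by simpa using h1))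
    · rintro ⟨_, ⟨⟨p, rfl⟩, hp⟩, hleast⟩
      have hp' : 0 < p := hmono.lt_iff_lt.1 (by simpa using hp)
      obtain ⟨q, hq0, hqp⟩ := exists_between hp'
      have hq : (0 : ℝ) < f q := by simpa using hmono hq0
      exact absurd (hmono hqp) (not_lt.2 (hleast ⟨⟨q, rfl⟩, hq⟩))
  obtain ⟨_, ⟨l, rfl⟩, hl⟩ := hdense.exists_lt r
  obtain ⟨_, ⟨m, rfl⟩, hm⟩ := hdense.exists_gt r
  obtain ⟨s, hs⟩ := hsup {p | f p ≤ r} ⟨l, hl.le⟩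
    ⟨m, fun p hp => hmono.le_iff_le.1 (le_trans hp hm.le)⟩
  refine ⟨s, ?_⟩
  rcases lt_trichotomy (f s) r with h | h | h
  · obtain ⟨_, ⟨p, rfl⟩, h1, h2⟩ := hdense.exists_between h
    exact absurd (hs.1 (show f p ≤ r from h2.le)) (not_le.2 (hmono.lt_iff_lt.1 h1))
  · exact h
  · obtain ⟨_, ⟨p, rfl⟩, h1, h2⟩ := hdense.exists_between h
    have : p ∈ upperBounds {p | f p ≤ r} := fun q hq => hmono.le_iff_le.1 (le_trans hq h1.le)
    exact absurd (hs.2 this) (not_le.2 (hmono.lt_iff_lt.1 h2))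

/-- A congruence on a dense complete line is equality of differences of a real coordinate. -/
theorem LineCongruence.exists_coordinate {P : Type u} [LinearOrder P] [DenselyOrdered P]
    [Nontrivial P] {C : P → P → P → P → Prop} (h : LineCongruence P C)
    (hsup : ∀ B : Set P, B.Nonempty → BddAbove B → ∃ s, IsLUB B s) :
    ∃ F : P → ℝ, StrictMono F ∧ Function.Surjective F ∧
      ∀ a b c d, C a b c d ↔ F b - F a = F d - F c := by
  obtain ⟨o, -⟩ := exists_pair_ne P
  let := h.addCommGroup o
  have hadd : ∀ p q : P, C o q p (p + q) := fun p q => h.translate_spec o q p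
  have : IsOrderedAddMonoid P := by
    -- The intervals `[a, b]` and `[c + a, c + b]` are congruent, and congruence preserves
    -- direction.
    have key : ∀ a b c : P, a < b → c + a < c + b := fun a b c hab =>
      h.lt_of_lt hab (h.add (h.convert (hadd c a)) (hadd c b))
    have key' : ∀ a b : P, a ≤ b → ∀ c, c + a ≤ c + b := fun a b hab c =>
      hab.lt_or_eq.elim (fun hl => (key a b c hl).le) (fun he => by rw [he])
    exact { add_le_add_left := fun a b hab c => by
              rw [add_comm a, add_comm b]; exact key' a b hab c }
  obtain ⟨f, hf, hs⟩ := exists_strictMono_surjective_real hsup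
  -- Every interval is moved to the origin, where congruent intervals have equal endpoints.
  have hdiff : ∀ a b, C a b o (b - a) := fun a b => by
    have := hadd a (b - a)
    rw [add_sub_cancel] at this
    exact h.symm this
  refine ⟨f, hf, hs, fun a b c d => ?_⟩
  rw [← map_sub, ← map_sub, hf.injective.eq_iff]
  constructor
  · intro h1
    exact h.unique (h.trans (h.symm h1) (hdiff a b)) (hdiff c d)
  · intro h1
    exact h.trans (hdiff a b) (h1 ▸ h.symm (hdiff c d))

/-! ### The measure of intervals exists -/

namespace Interpretation

variable {M : Interpretation.{u}}

namespace PitchAxioms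

variable (h : M.PitchAxioms)
include h

lemma ident_equivalence : Equivalence (Identical M.lower) where
  refl x := by simp [Identical, h.irrefl]
  symm {x y} hxy := by simpa [Identical, and_comm] using hxy
  trans {x y z} hxy hyz := by
    have hzy : Identical M.lower z y := by simpa [Identical, and_comm] using hyz
    rintro (hl | hl)
    · exact h.separation _ _ _ hl ⟨hxy, hzy⟩
    · exact h.separation _ _ _ hl ⟨hzy, hxy⟩

lemma mk_eq_iff {x y : M.Sound} :
    (Quot.mk (Identical M.lower) x = Quot.mk _ y) ↔ M.ident x y :=
  ⟨fun he => h.ident_equivalence.eqvGen_iff.1 (Quot.eqvGen_exact he), fun he => Quot.sound he⟩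

/-- Separation is what makes `lower` a strict weak order, so that it descends to a linear order of
pitch classes. -/
lemma not_lower_trans {x y z : M.Sound} (hxy : ¬ M.lower y x) (hyz : ¬ M.lower z y) :
    ¬ M.lower z x := by
  intro hzx
  by_cases h1 : M.lower x y
  · exact hyz (h.trans _ _ _ hzx h1)
  · by_cases h2 : M.lower y z
    · exact hxy (h.trans _ _ _ h2 hzx)
    · exact h.separation z x y hzx ⟨by simp [ident, Identical, *], by simp [ident, Identical, *]⟩

lemma lower_congr {x x' y y' : M.Sound} (hx : M.ident x x') (hy : M.ident y y')
    (hl : M.lower x y) : M.lower x' y' := by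
  by_contra hn
  have h1 : ¬ M.lower x y' := h.not_lower_trans hn (fun hc => hx (Or.inl hc))
  exact h.not_lower_trans (fun hc => hy (Or.inr hc)) h1 hl

end PitchAxioms

/-- Pitch order of pitch classes. -/
abbrev PitchAxioms.linearOrder (h : M.PitchAxioms) : LinearOrder (Quot (Identical M.lower)) where
  le p q := Quot.liftOn₂ p q (fun x y => ¬ M.lower y x)
    (fun x y y' hy => propext (not_congr
      ⟨h.lower_congr hy (h.ident_equivalence.refl x),
        h.lower_congr (h.ident_equivalence.symm hy) (h.ident_equivalence.refl x)⟩))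
    (fun x x' y hx => propext (not_congr
      ⟨h.lower_congr (h.ident_equivalence.refl y) hx,
        h.lower_congr (h.ident_equivalence.refl y) (h.ident_equivalence.symm hx)⟩))
  le_refl := by rintro ⟨x⟩; exact h.irrefl x
  le_trans := by rintro ⟨x⟩ ⟨y⟩ ⟨z⟩; exact h.not_lower_trans
  le_antisymm := by
    rintro ⟨x⟩ ⟨y⟩ h1 h2
    exact Quot.sound (fun hc => hc.elim h2 h1)
  le_total := by
    rintro ⟨x⟩ ⟨y⟩
    by_contra! hn
    exact h.irrefl x (h.trans _ _ _ (not_not.1 hn.2) (not_not.1 hn.1))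
  toDecidableLE := Classical.decRel _

lemma PitchAxioms.mk_lt_iff (h : M.PitchAxioms) {x y : M.Sound} :
    (h.linearOrder.lt (Quot.mk _ x) (Quot.mk _ y)) ↔ M.lower x y := by
  let := h.linearOrder
  exact not_le.symm.trans not_not

lemma exists_coordinate (h : M.PitchAxioms) (hI : M.IntervalAxioms) :
    ∃ F : M.Sound → ℝ, (∀ x y, F x < F y ↔ M.lower x y) ∧ Function.Surjective F ∧
      ∀ a b c d, M.cong (M.interval a b) (M.interval c d) ↔ F b - F a = F d - F c := by
  let := h.linearOrder
  have hlt : ∀ {x y : M.Sound}, (Quot.mk (Identical M.lower) x < Quot.mk _ y) ↔ M.lower x y :=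
    h.mk_lt_iff
  have hdense : DenselyOrdered (Quot (Identical M.lower)) := by
    refine ⟨?_⟩
    rintro ⟨x⟩ ⟨y⟩ hxy
    obtain ⟨a, h1, h2⟩ := h.between_two x y (hlt.1 hxy)
    exact ⟨Quot.mk _ a, hlt.2 h1, hlt.2 h2⟩
  have hnontriv : Nontrivial (Quot (Identical M.lower)) := by
    obtain ⟨x, y, hxy⟩ := h.existence
    exact ⟨Quot.mk _ x, Quot.mk _ y, fun he => h.mk_eq_iff.1 he hxy⟩
  have hC : LineCongruence (Quot (Identical M.lower)) (fun a b c d => M.cong (a, b) (c, d)) :=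
    { refl := fun a b => hI.cong_refl _
      trans := fun h1 h2 => hI.cong_trans _ _ _ h1 h2
      motion := by
        rintro ⟨x⟩ ⟨y⟩ ⟨a⟩
        obtain ⟨b, hb, hu⟩ := hI.motion x y a
        refine ⟨Quot.mk _ b, hb, ?_⟩
        rintro ⟨b'⟩ hb'
        exact Quot.sound (hu b' hb')
      lt_of_lt := by
        rintro ⟨a⟩ ⟨b⟩ ⟨c⟩ ⟨d⟩ hl hc
        exact hlt.2 (hI.regularity_lower a b c d (hlt.1 hl) hc)
      conversion := by
        rintro ⟨a⟩ ⟨b⟩ ⟨c⟩ ⟨d⟩ hl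
        exact hI.regularity_conversion a b c d (hlt.1 hl)
      crossed_add := by
        rintro ⟨a⟩ ⟨b⟩ ⟨c⟩ ⟨a'⟩ ⟨b'⟩ ⟨c'⟩ h1 h2
        exact hI.addition_conversion a b c a' b' c' (hlt.1 h1) (hlt.1 h2) }
  have hsup : ∀ B : Set (Quot (Identical M.lower)), B.Nonempty → BddAbove B →
      ∃ s, IsLUB B s := by
    intro B hB hbdd
    -- A maximum is a supremum at once. Otherwise the sounds that do not bound `B` from above are
    -- nonempty and form a cut with the upper bounds.
    by_cases hub : ∃ u ∈ upperBounds B, u ∈ B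
    · obtain ⟨u, hu, huB⟩ := hub
      exact ⟨u, hu, fun v hv => hv huB⟩
    push Not at hub
    obtain ⟨⟨b⟩, hb⟩ := hB
    obtain ⟨⟨v⟩, hv⟩ := hbdd
    let Q : Set M.Sound := {x | Quot.mk _ x ∈ upperBounds B}
    have hsep : ∀ p ∈ Qᶜ, ∀ q ∈ Q, ¬ M.lower q p := by
      intro p hp q hq hl
      exact hp (fun c hc => (hq hc).trans (hlt.2 hl).le)
    have hcut : M.IsCut Qᶜ Q :=
      ⟨⟨b, fun hc => hub _ hc hb⟩, ⟨v, hv⟩, Set.compl_union_self Q, Set.compl_inter_self Q,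
        Or.inr hsep⟩
    obtain ⟨θ, ⟨h1, h2⟩ | ⟨h1, h2⟩⟩ := hI.dedekind _ _ hcut
    · refine ⟨Quot.mk _ θ, ?_, ?_⟩
      · intro c hc
        by_contra hn
        obtain ⟨m, hm1, hm2⟩ := exists_between (not_le.1 hn)
        obtain ⟨m, rfl⟩ := Quot.exists_rep m
        exact absurd (h2 m (hlt.1 hm1) hc) (not_le.2 hm2)
      · rintro ⟨u⟩ hu
        by_contra hn
        exact h1 u (hlt.1 (not_le.1 hn)) hu
    -- The reversed orientation is impossible: a sound below `θ` would be an upper bound, while one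
    -- above `θ` would not.
    · obtain ⟨x, y, hx, hy⟩ := h.between_some θ
      exact absurd (h.trans _ _ _ hx hy) (hsep y (h2 y hy) x (h1 x hx))
  obtain ⟨F, hF, hFs, hFC⟩ := hC.exists_coordinate hsup
  refine ⟨fun x => F (Quot.mk _ x), fun x y => ?_, ?_, fun a b c d => hFC _ _ _ _⟩
  · exact hF.lt_iff_lt.trans hlt
  · intro r
    obtain ⟨⟨x⟩, hx⟩ := hFs r
    exact ⟨x, hx⟩

/-- The quotients of a coordinate of sounds that is positive, onto, and compatible with pitch and
congruence are a measure of intervals. -/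
lemma isMeasure_of_coordinate (G : M.Sound → ℝ) (hpos : ∀ x, 0 < G x)
    (hlt : ∀ x y, G x < G y ↔ M.lower x y) (hs : ∀ r, 0 < r → ∃ x, G x = r)
    (hC : ∀ a b c d, M.cong (M.interval a b) (M.interval c d) ↔ G b / G a = G d / G c)
    (hbase : G M.y₀ / G M.x₀ = M.lam) :
    ∃ μ, M.IsMeasure μ ∧ ∀ a b, μ (M.interval a b) = G b / G a := by
  have hGi : ∀ x y, Identical M.lower x y → G x = G y := fun x y hxy =>
    le_antisymm (not_lt.1 fun hl => hxy (Or.inr ((hlt _ _).1 hl)))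
      (not_lt.1 fun hl => hxy (Or.inl ((hlt _ _).1 hl)))
  let μ : M.Interval → ℝ := fun I => Quot.lift G hGi I.2 / Quot.lift G hGi I.1
  have hμ : ∀ a b, μ (M.interval a b) = G b / G a := fun a b => rfl
  refine ⟨μ, ?_, hμ⟩
  refine ⟨?_, hbase, ?_, ?_, ?_, ?_, ?_, ?_⟩
  · rintro ⟨⟨a⟩, ⟨b⟩⟩
    exact div_pos (hpos b) (hpos a)
  · intro a b
    rw [hμ, div_lt_one (hpos a), hlt]
  · intro a b
    rw [hμ, div_eq_one_iff_eq (hpos a).ne']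
    refine ⟨?_, fun hab => (hGi a b hab).symm⟩
    rintro he (hl | hl)
    · exact (((hlt _ _).2 hl).ne he.symm)
    · exact (((hlt _ _).2 hl).ne he)
  · intro a b
    rw [hμ, one_lt_div (hpos a), hlt]
  · rintro ⟨⟨a⟩, ⟨b⟩⟩ ⟨⟨c⟩, ⟨d⟩⟩
    exact (hC a b c d).symm
  · intro a b c
    rw [hμ, hμ, hμ]
    have := (hpos a).ne'
    have := (hpos b).ne'
    field_simp
  · intro r hr
    obtain ⟨x, hx⟩ := hs (r * G M.x₀) (mul_pos hr (hpos _))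
    have hxr : G x / G M.x₀ = r := by rw [hx, mul_div_cancel_right₀ _ (hpos _).ne']
    refine ⟨M.interval M.x₀ x, hxr, ?_⟩
    rintro ⟨⟨c⟩, ⟨d⟩⟩ hcd
    exact (hC _ _ c d).2 (hxr.trans hcd.symm)

namespace IsModelPI

lemma isMeasure_measure (h : M.IsModelPI) : M.IsMeasure M.measure := by
  obtain ⟨F, hF, hFs, hFC⟩ := exists_coordinate h.pitch h.intervals
  -- This scale makes the exponential of the coordinate grow by the factor `M.lam` on the base
  -- interval.
  set k : ℝ := Real.log M.lam / (F M.y₀ - F M.x₀) with hk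
  have hbase : 0 < F M.y₀ - F M.x₀ := sub_pos.2 ((hF _ _).2 h.base_lower)
  have hk0 : 0 < k := div_pos (Real.log_pos h.one_lt_lam) hbase
  have hdiv : ∀ a b, Real.exp (k * F b) / Real.exp (k * F a) = Real.exp (k * (F b - F a)) :=
    fun a b => by rw [← Real.exp_sub, mul_sub]
  obtain ⟨μ, hμ, -⟩ := isMeasure_of_coordinate (M := M) (fun x => Real.exp (k * F x))
    (fun x => Real.exp_pos _)
    (fun x y => by rw [Real.exp_lt_exp, mul_lt_mul_iff_right₀ hk0, hF])
    (fun r hr => by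
      obtain ⟨x, hx⟩ := hFs (Real.log r / k)
      exact ⟨x, by rw [hx, mul_div_cancel₀ _ hk0.ne', Real.exp_log hr]⟩)
    (fun a b c d => by
      rw [hFC, hdiv, hdiv, Real.exp_eq_exp, mul_right_inj' hk0.ne'])
    (by
      rw [hdiv, hk, div_mul_cancel₀ _ hbase.ne', Real.exp_log (by linarith [h.one_lt_lam])])
  exact Classical.epsilon_spec ⟨μ, hμ⟩

variable (h : M.IsModelPI)
include h

lemma measure_pos (a b : M.Sound) : 0 < M.measure (M.interval a b) :=
  h.isMeasure_measure.pos _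

lemma frequency_pos (x : M.Sound) : 0 < M.frequency x :=
  mul_pos h.f₀_pos (h.measure_pos _ _)

lemma measure_eq_div (a b : M.Sound) :
    M.measure (M.interval a b) = M.frequency b / M.frequency a := by
  have h1 := h.isMeasure_measure.mul M.x₀ a b
  have h2 := (h.measure_pos M.x₀ a).ne'
  have h3 := h.f₀_pos.ne'
  rw [frequency, frequency, h1]
  field_simp

lemma lower_iff (a b : M.Sound) : M.lower a b ↔ M.frequency a < M.frequency b := by
  rw [← h.isMeasure_measure.one_lt_iff, h.measure_eq_div, one_lt_div (h.frequency_pos a)]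

lemma ident_iff (a b : M.Sound) : M.ident a b ↔ M.frequency a = M.frequency b := by
  rw [← h.isMeasure_measure.eq_one_iff, h.measure_eq_div,
    div_eq_one_iff_eq (h.frequency_pos a).ne', eq_comm]

lemma cong_iff (a b c d : M.Sound) : M.cong (M.interval a b) (M.interval c d) ↔
    M.frequency b / M.frequency a = M.frequency d / M.frequency c := by
  rw [← h.isMeasure_measure.eq_iff, h.measure_eq_div, h.measure_eq_div]

lemma interval_eq_iff (a b c d : M.Sound) : M.interval a b = M.interval c d ↔
    M.frequency a = M.frequency c ∧ M.frequency b = M.frequency d := by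
  rw [interval, interval, Prod.mk.injEq, h.pitch.mk_eq_iff, h.pitch.mk_eq_iff, h.ident_iff,
    h.ident_iff]

lemma exists_frequency_eq {r : ℝ} (hr : 0 < r) (a : M.Sound) :
    ∃ b, M.frequency b = r * M.frequency a := by
  obtain ⟨⟨⟨c⟩, ⟨d⟩⟩, hI, -⟩ := h.isMeasure_measure.surj r hr
  obtain ⟨b, hb, -⟩ := h.intervals.motion c d a
  refine ⟨b, ?_⟩
  rw [h.cong_iff, ← h.measure_eq_div] at hb
  have : M.measure (M.interval c d) = r := hI
  rw [this, eq_div_iff (h.frequency_pos a).ne'] at hb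
  exact hb.symm

end IsModelPI

/-! ### Isomorphism of models of pitch, intervals, loudness and colour -/

lemma timbre_timbreEquiv {M₁ : Interpretation.{v}} {M₂ : Interpretation.{w}}
    (h₁ : M₁.IsModelPIStar) (h₂ : M₂.IsModelPIStar) (x : M₁.Sound) :
    M₂.timbre ((h₁.timbreEquiv.trans h₂.timbreEquiv.symm) x) = M₁.timbre x :=
  h₂.timbreEquiv.apply_symm_apply _

theorem isIso_timbreEquiv {M₁ : Interpretation.{v}} {M₂ : Interpretation.{w}}
    (h₁ : M₁.IsModelPIStar) (h₂ : M₂.IsModelPIStar) :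
    IsIso M₁ M₂ (h₁.timbreEquiv.trans h₂.timbreEquiv.symm) := by
  have ht := timbre_timbreEquiv h₁ h₂
  have hf : ∀ x, M₂.frequency ((h₁.timbreEquiv.trans h₂.timbreEquiv.symm) x) =
      M₁.frequency x := fun x => by
    rw [← (h₁.colour x).1, ← (h₂.colour _).1, ht]
  refine ⟨fun x y => ?_, fun a b c d => ?_, ht, fun x => ?_, hf⟩
  · rw [h₁.lower_iff, h₂.lower_iff, hf, hf]
  · rw [h₁.cong_iff, h₂.cong_iff, hf, hf, hf, hf]
  · rw [← (h₁.colour x).2, ← (h₂.colour _).2, ht]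

end Interpretation

/-! ### Uniqueness of the measure -/

/-- A monotone additive real function that fixes a positive number is the identity. -/
lemma additive_monotone_eq_id (φ : ℝ →+ ℝ) (hφ : Monotone φ) {b : ℝ} (hb : 0 < b)
    (hfix : φ b = b) (t : ℝ) : φ t = t := by
  -- The number `n * t` lies between consecutive integral multiples of `b`, which `φ` fixes; hence
  -- the error at `n * t`, which is `n` times the error at `t`, never exceeds `b`.
  have hbound : ∀ n : ℕ, n * |φ t - t| ≤ b := by
    intro n
    have h1 : (⌊n * t / b⌋ : ℝ) * b ≤ n * t := (le_div_iff₀ hb).1 (Int.floor_le _)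
    have h2 : n * t ≤ (⌊n * t / b⌋ + 1 : ℝ) * b :=
      ((div_lt_iff₀ hb).1 (Int.lt_floor_add_one _)).le
    have hn : φ (n * t) = n * φ t := by rw [← nsmul_eq_mul, map_nsmul, nsmul_eq_mul]
    have hz : ∀ m : ℤ, φ (m * b) = m * b := fun m => by
      rw [← zsmul_eq_mul, map_zsmul, hfix]
    have h3 := hφ h1
    have h4 := hφ h2
    have h5 := hz (⌊n * t / b⌋ + 1)
    push_cast at h5
    rw [hn, hz] at h3
    rw [hn, h5] at h4
    rw [← Nat.abs_cast n, ← abs_mul, abs_le]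
    constructor <;> linarith
  by_contra hne
  have hpos : 0 < |φ t - t| := abs_pos.2 (sub_ne_zero.2 hne)
  obtain ⟨n, hn⟩ := exists_nat_gt (b / |φ t - t|)
  exact absurd (hbound n) (not_le.2 ((div_lt_iff₀ hpos).1 hn))

namespace Interpretation

variable {M : Interpretation.{u}}

/-- Both measures classify congruence, so `ν` is a function of `μ`. In logarithmic scale this
function is additive and monotone and fixes `log M.lam`, hence is the identity. -/
lemma IsMeasure.eq_div_of_coordinate {μ ν : M.Interval → ℝ} (hμ : M.IsMeasure μ)
    (hν : M.IsMeasure ν) (hlam : 1 < M.lam) (G : M.Sound → ℝ) (hpos : ∀ x, 0 < G x)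
    (hs : ∀ r, 0 < r → ∃ x, G x = r) (hμG : ∀ a b, μ (M.interval a b) = G b / G a)
    (a b : M.Sound) : ν (M.interval a b) = G b / G a := by
  have hμν : ∀ I J, μ I = μ J → ν I = ν J := fun I J he =>
    (hν.eq_iff I J).2 ((hμ.eq_iff I J).1 he)
  have hmono : ∀ a b c, G b ≤ G c → ν (M.interval a b) ≤ ν (M.interval a c) := by
    intro a b c hbc
    rw [hν.mul a b c]
    refine le_mul_of_one_le_right (hν.pos _).le (not_lt.1 fun hl => ?_)
    rw [hν.lt_one_iff, ← hμ.lt_one_iff, hμG, div_lt_one (hpos b)] at hl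
    exact absurd hl (not_lt.2 hbc)
  -- `X t` is a sound whose interval from `a` has `μ`-measure `exp t`.
  choose X hX using fun t : ℝ => hs (Real.exp t * G a) (mul_pos (Real.exp_pos t) (hpos a))
  have hself : ν (M.interval a a) = 1 := by
    rw [hν.eq_one_iff, ← hμ.eq_one_iff, hμG, div_self (hpos a).ne']
  let φ : ℝ →+ ℝ := AddMonoidHom.mk' (fun t => Real.log (ν (M.interval a (X t)))) (by
    intro s t
    rw [← Real.log_mul (hν.pos _).ne' (hν.pos _).ne', hν.mul a (X s) (X (s + t))]
    congr 2
    apply hμν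
    rw [hμG, hμG, hX, hX, hX, Real.exp_add]
    have := (hpos a).ne'
    have := (Real.exp_pos s).ne'
    field_simp)
  have hφ : Monotone φ := fun s t hst =>
    Real.log_le_log (hν.pos _) (hmono _ _ _ (by
      rw [hX, hX]
      exact mul_le_mul_of_nonneg_right (Real.exp_le_exp.2 hst) (hpos a).le))
  have hlam0 : 0 < M.lam := by linarith
  have hfix : φ (Real.log M.lam) = Real.log M.lam := by
    change Real.log (ν (M.interval a (X _))) = _
    rw [← hν.base]
    congr 1
    apply hμν
    rw [hμ.base, hμG, hX, hν.base, Real.exp_log hlam0, mul_div_cancel_right₀ _ (hpos a).ne']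
  have hid := additive_monotone_eq_id φ hφ (Real.log_pos hlam) hfix (Real.log (G b / G a))
  change Real.log (ν (M.interval a (X _))) = _ at hid
  have hba : 0 < G b / G a := div_pos (hpos b) (hpos a)
  rw [← Real.log_injOn_pos (hν.pos _) hba hid]
  apply hμν
  rw [hμG, hμG, hX, Real.exp_log hba, div_mul_cancel₀ _ (hpos a).ne']

/-- The measure of intervals is the quotient of every suitable coordinate of sounds. -/
lemma measure_eq_div_of_coordinate (hlam : 1 < M.lam) (G : M.Sound → ℝ) (hpos : ∀ x, 0 < G x)
    (hlt : ∀ x y, G x < G y ↔ M.lower x y) (hs : ∀ r, 0 < r → ∃ x, G x = r)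
    (hC : ∀ a b c d, M.cong (M.interval a b) (M.interval c d) ↔ G b / G a = G d / G c)
    (hbase : G M.y₀ / G M.x₀ = M.lam) (a b : M.Sound) :
    M.measure (M.interval a b) = G b / G a := by
  obtain ⟨μ, hμ, hμG⟩ := isMeasure_of_coordinate G hpos hlt hs hC hbase
  exact hμ.eq_div_of_coordinate (Classical.epsilon_spec ⟨μ, hμ⟩) hlam G hpos hs hμG a b

end Interpretation

/-! ### Period and amplitude -/

namespace Cp

/-- Take `x`, `y` with different values and `δ` from continuity at `y`. A period below `δ` would
repeat the value at `x` within distance `δ` of `y`, where values are closer to `g y` than that.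
Hence all periods are at least `δ`. -/
lemma period_pos (g : Cp) : 0 < g.period := by
  obtain ⟨hc, ⟨T₀, hT₀⟩, x, y, hxy⟩ := g.2
  obtain ⟨δ, hδ, hclose⟩ := Metric.continuous_iff.1 hc y (dist (g.1 x) (g.1 y)) (dist_pos.2 hxy)
  refine lt_of_lt_of_le hδ (le_csInf ⟨T₀, hT₀⟩ ?_)
  rintro T ⟨hT, hper⟩
  by_contra! hlt
  obtain ⟨z, ⟨hz1, hz2⟩, hz⟩ := hper.exists_mem_Ico hT x y
  have := hclose z (by rw [Real.dist_eq, abs_of_nonneg (by linarith)]; linarith)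
  rw [hz] at this
  exact lt_irrefl _ this

lemma amplitude_pos (g : Cp) : 0 < g.amplitude := by
  obtain ⟨hc, ⟨T, hT, hper⟩, x, y, hxy⟩ := g.2
  exact (dist_pos.2 hxy).trans_le (Metric.dist_le_diam_of_mem
    (hper.isBounded_of_continuous hT.ne' hc) ⟨x, rfl⟩ ⟨y, rfl⟩)

/-- Every period and every amplitude are realized by a sine wave. -/
lemma exists_period_amplitude {T A : ℝ} (hT : 0 < T) (hA : 0 < A) :
    ∃ g : Cp, g.period = T ∧ g.amplitude = A := by
  set g : ℝ → ℝ := fun x => A / 2 * Real.sin (2 * Real.pi / T * x) with hg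
  have hpi := Real.pi_pos
  have hk : 0 < 2 * Real.pi / T := by positivity
  have hcont : Continuous g := by fun_prop
  have hper : Function.Periodic g T := fun x => by
    rw [hg]
    simp only
    rw [mul_add, div_mul_cancel₀ _ hT.ne', Real.sin_add_two_pi]
  -- A quarter period from the origin the sine is maximal. A period `c` must therefore return to the
  -- maximum, which forces the cosine to be 1 and `c` to be a multiple of `T`.
  have hquarter : ∀ c : ℝ, g (T / 4 + c) = A / 2 * Real.cos (2 * Real.pi / T * c) := fun c => by
    rw [hg]
    simp only
    rw [← Real.sin_add_pi_div_two]
    congr 2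
    field_simp
    ring
  have hrange : Set.range g = Set.Icc (-(A / 2)) (A / 2) := by
    ext r
    constructor
    · rintro ⟨x, rfl⟩
      have h1 := Real.neg_one_le_sin (2 * Real.pi / T * x)
      have h2 := Real.sin_le_one (2 * Real.pi / T * x)
      simp only [hg, Set.mem_Icc]
      constructor <;> nlinarith
    · rintro ⟨h1, h2⟩
      refine ⟨Real.arcsin (r / (A / 2)) / (2 * Real.pi / T), ?_⟩
      simp only [hg]
      rw [mul_div_cancel₀ _ hk.ne', Real.sin_arcsin, mul_div_cancel₀ _ (by positivity)]
      · rw [le_div_iff₀ (by positivity)]; linarith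
      · rw [div_le_iff₀ (by positivity)]; linarith
  have hne : g (T / 4 + 0) ≠ g 0 := by
    rw [hquarter]
    simp [hg, hA.ne']
  refine ⟨⟨g, hcont, ⟨T, hT, hper⟩, _, _, hne⟩, ?_, ?_⟩
  · refine IsLeast.csInf_eq ⟨⟨hT, hper⟩, ?_⟩
    rintro c ⟨hc, hcper⟩
    have h1 : g (T / 4 + c) = g (T / 4 + 0) := by rw [add_zero]; exact hcper (T / 4)
    rw [hquarter, hquarter, mul_zero, Real.cos_zero, mul_right_inj' (by positivity),
      Real.cos_eq_one_iff] at h1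
    obtain ⟨n, hn⟩ := h1
    have hnc : (n : ℝ) * T = c := by
      field_simp at hn
      linarith
    have hn0 : (0 : ℝ) < n := pos_of_mul_pos_left (hnc ▸ hc) hT.le
    have hn1 : (1 : ℝ) ≤ n := by exact_mod_cast Int.add_one_le_iff.2 (Int.cast_pos.1 hn0)
    nlinarith
  · change Metric.diam (Set.range g) = A
    rw [hrange, Real.diam_Icc (by linarith)]
    ring

/-! ### The model of all timbres -/

/-- The quotient of the periods at the ends of an interval. -/
def pitchRatio (I : Quot (Identical fun x y : ULift.{u} Cp => x.down.period < y.down.period) ×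
    Quot (Identical fun x y : ULift.{u} Cp => x.down.period < y.down.period)) : ℝ :=
  Quot.lift (fun x => x.down.period) (fun _ _ h =>
      le_antisymm (not_lt.1 fun hl => h (Or.inr hl)) (not_lt.1 fun hl => h (Or.inl hl))) I.2 /
    Quot.lift (fun x => x.down.period) (fun _ _ h =>
      le_antisymm (not_lt.1 fun hl => h (Or.inr hl)) (not_lt.1 fun hl => h (Or.inl hl))) I.1

/-- The interpretation in which sounds are their own timbres, with base interval `[g₀, g₁]`. -/
def interpretation (g₀ g₁ : Cp) : Interpretation.{u} where
  Sound := ULift.{u} Cp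
  lower x y := x.down.period < y.down.period
  cong I J := pitchRatio I = pitchRatio J
  x₀ := ⟨g₀⟩
  y₀ := ⟨g₁⟩
  lam := g₁.period / g₀.period
  f₀ := g₀.period
  i₀ := g₀.amplitude
  intensity x := x.down.amplitude
  timbre x := x.down

variable {g₀ g₁ : Cp}

/-- The period of a sound of the model of all timbres. -/
def soundPeriod (x : (interpretation.{u} g₀ g₁).Sound) : ℝ := period (ULift.down x)

lemma soundPeriod_pos (x : (interpretation.{u} g₀ g₁).Sound) : 0 < soundPeriod x :=
  period_pos _

lemma interpretation_cong_iff (a b c d : (interpretation.{u} g₀ g₁).Sound) :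
    (interpretation g₀ g₁).cong ((interpretation g₀ g₁).interval a b)
      ((interpretation g₀ g₁).interval c d) ↔
    soundPeriod b / soundPeriod a = soundPeriod d / soundPeriod c := Iff.rfl

lemma interpretation_ident_iff (a b : (interpretation.{u} g₀ g₁).Sound) :
    (interpretation g₀ g₁).ident a b ↔ soundPeriod a = soundPeriod b := by
  change ¬ (soundPeriod a < soundPeriod b ∨ soundPeriod b < soundPeriod a) ↔ _
  rw [← ne_iff_lt_or_gt, not_not]

lemma exists_soundPeriod {T : ℝ} (hT : 0 < T) : ∃ x : (interpretation.{u} g₀ g₁).Sound, soundPeriod x = T := by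
  obtain ⟨g, hg, -⟩ := exists_period_amplitude hT one_pos
  exact ⟨⟨g⟩, hg⟩

/-- Since `measure` is an arbitrary choice among measures, computing it in the concrete model
requires uniqueness. -/
lemma interpretation_measure (h : g₀.period < g₁.period) (a b : (interpretation.{u} g₀ g₁).Sound) :
    (interpretation g₀ g₁).measure ((interpretation g₀ g₁).interval a b) =
      soundPeriod b / soundPeriod a :=
  Interpretation.measure_eq_div_of_coordinate ((one_lt_div g₀.period_pos).2 h)
    soundPeriod soundPeriod_pos (fun _ _ => Iff.rfl)
    (fun _ hr => exists_soundPeriod hr) interpretation_cong_iff rfl a b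

lemma interpretation_frequency (h : g₀.period < g₁.period) (a : (interpretation.{u} g₀ g₁).Sound) :
    (interpretation g₀ g₁).frequency a = soundPeriod a := by
  change g₀.period * (interpretation g₀ g₁).measure _ = _
  rw [interpretation_measure h]
  exact mul_div_cancel₀ _ g₀.period_pos.ne'

lemma interpretation_pitchAxioms : (interpretation.{u} g₀ g₁).PitchAxioms where
  irrefl x := lt_irrefl _
  trans x y z := lt_trans
  existence := by
    obtain ⟨x, hx⟩ := exists_soundPeriod one_pos
    obtain ⟨y, hy⟩ := exists_soundPeriod two_pos
    refine ⟨x, y, Or.inl ?_⟩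
    change soundPeriod x < soundPeriod y
    rw [hx, hy]
    norm_num
  separation x y z hxy hz := by
    rw [interpretation_ident_iff, interpretation_ident_iff] at hz
    exact hxy.ne (hz.1.trans hz.2.symm)
  between_some x := by
    have hx := (soundPeriod_pos x)
    obtain ⟨a, ha⟩ := exists_soundPeriod (half_pos hx)
    obtain ⟨b, hb⟩ := exists_soundPeriod (mul_pos two_pos hx)
    refine ⟨a, b, ?_, ?_⟩
    · change soundPeriod a < soundPeriod x
      linarith
    · change soundPeriod x < soundPeriod b
      linarith
  between_two x y hxy := by
    obtain ⟨r, h1, h2⟩ := exists_between (show soundPeriod x < soundPeriod y from hxy)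
    obtain ⟨a, ha⟩ := exists_soundPeriod ((soundPeriod_pos x).trans h1)
    rw [← ha] at h1 h2
    exact ⟨a, h1, h2⟩

/-- The cut sound is one whose period is the supremum of the periods in `P`; this is positive
because `P` is nonempty. -/
lemma exists_cut_number {P Q : Set (interpretation.{u} g₀ g₁).Sound} (hP : P.Nonempty) (hQ : Q.Nonempty)
    (hun : P ∪ Q = Set.univ) (hsep : ∀ p ∈ P, ∀ q ∈ Q, ¬ soundPeriod q < soundPeriod p) :
    ∃ θ : (interpretation.{u} g₀ g₁).Sound, (∀ x : (interpretation.{u} g₀ g₁).Sound, soundPeriod x < soundPeriod θ → x ∈ P) ∧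
      ∀ x : (interpretation.{u} g₀ g₁).Sound, soundPeriod θ < soundPeriod x → x ∈ Q := by
  let B : Set ℝ := soundPeriod '' P
  obtain ⟨q, hq⟩ := hQ
  have hub : ∀ q ∈ Q, soundPeriod q ∈ upperBounds B := by
    rintro q hq _ ⟨p, hp, rfl⟩
    exact not_lt.1 (hsep p hp q hq)
  have hB : IsLUB B (sSup B) := isLUB_csSup (hP.image _) ⟨_, hub q hq⟩
  obtain ⟨p, hp⟩ := hP
  obtain ⟨θ, hθ⟩ := exists_soundPeriod ((soundPeriod_pos p).trans_le (hB.1 ⟨p, hp, rfl⟩))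
  have hcover : ∀ x, x ∈ P ∨ x ∈ Q := fun x => by
    rw [← Set.mem_union, hun]; trivial
  refine ⟨θ, fun x hx => ?_, fun x hx => ?_⟩
  · refine (hcover x).resolve_right fun hxQ => ?_
    rw [hθ] at hx
    exact absurd (hB.2 (hub x hxQ)) (not_le.2 hx)
  · refine (hcover x).resolve_left fun hxP => ?_
    rw [hθ] at hx
    exact absurd (hB.1 ⟨x, hxP, rfl⟩) (not_le.2 hx)

lemma interpretation_intervalAxioms : (interpretation.{u} g₀ g₁).IntervalAxioms where
  cong_refl I := rfl
  cong_trans I J K h1 h2 := Eq.trans h1 h2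
  motion x y a := by
    have hx := (soundPeriod_pos x)
    have hy := (soundPeriod_pos y)
    have ha := (soundPeriod_pos a)
    obtain ⟨b, hb⟩ := exists_soundPeriod (mul_pos (div_pos hy hx) ha)
    refine ⟨b, ?_, fun b' hb' => ?_⟩
    · rw [interpretation_cong_iff, hb, mul_div_cancel_right₀ _ ha.ne']
    · rw [interpretation_cong_iff, eq_div_iff ha.ne'] at hb'
      rw [interpretation_ident_iff, hb, hb']
  regularity_lower a b c d hab h := by
    rw [interpretation_cong_iff] at h
    change soundPeriod c < soundPeriod d
    rw [← one_lt_div (soundPeriod_pos c), ← h, one_lt_div (soundPeriod_pos a)]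
    exact hab
  regularity_conversion a b c d _ := by
    rw [interpretation_cong_iff, interpretation_cong_iff, ← inv_div (soundPeriod a),
      ← inv_div (soundPeriod c), inv_inj]
  addition a b c a' b' c' _ _ h1 h2 := by
    rw [interpretation_cong_iff] at *
    have hb := (soundPeriod_pos b).ne'
    have hb' := (soundPeriod_pos b').ne'
    rw [← div_mul_div_cancel₀ hb, h2, h1]
    field_simp
  addition_conversion a b c a' b' c' _ _ h1 h2 := by
    rw [interpretation_cong_iff] at *
    have hb := (soundPeriod_pos b).ne'
    have hb' := (soundPeriod_pos b').ne'
    rw [← div_mul_div_cancel₀ hb, h2, h1]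
    field_simp
  dedekind P Q h := by
    obtain ⟨hP, hQ, hun, -, h | h⟩ := h
    · obtain ⟨θ, h1, h2⟩ := exists_cut_number hQ hP (Set.union_comm P Q ▸ hun)
        (fun p hp q hq => h q hq p hp)
      exact ⟨θ, Or.inr ⟨h1, h2⟩⟩
    · obtain ⟨θ, h1, h2⟩ := exists_cut_number hP hQ hun h
      exact ⟨θ, Or.inl ⟨h1, h2⟩⟩

theorem interpretation_isModelPIStar (h : g₀.period < g₁.period) :
    (interpretation.{u} g₀ g₁).IsModelPIStar where
  pitch := interpretation_pitchAxioms
  intervals := interpretation_intervalAxioms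
  base_lower := h
  one_lt_lam := (one_lt_div g₀.period_pos).2 h
  f₀_pos := g₀.period_pos
  i₀_pos := g₀.amplitude_pos
  loudness c hc := by
    have hA := g₀.amplitude_pos
    refine ⟨fun x : (interpretation.{u} g₀ g₁).Sound => c / g₀.amplitude * amplitude (ULift.down x),
      fun x => mul_pos (div_pos hc hA) (amplitude_pos _), div_mul_cancel₀ _ hA.ne', ?_⟩
    intro r hr s
    obtain ⟨g, hg1, hg2⟩ := exists_period_amplitude (soundPeriod_pos s)
      (mul_pos (div_pos hA hc) hr)
    refine ⟨⟨g⟩, (interpretation_ident_iff _ _).2 hg1, ?_⟩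
    change c / g₀.amplitude * g.amplitude = r
    rw [hg2]
    field_simp
  intensity_spec := by
    refine ⟨fun x => amplitude_pos _, rfl, fun r hr s => ?_⟩
    obtain ⟨g, hg1, hg2⟩ := exists_period_amplitude (soundPeriod_pos s) hr
    exact ⟨⟨g⟩, (interpretation_ident_iff _ _).2 hg1, hg2⟩
  colour x := ⟨(interpretation_frequency h x).symm, rfl⟩
  extensionality x y hxy := ULift.ext _ _ hxy
  timbre_onto g := ⟨⟨g⟩, rfl⟩

end Cp

/-! ### Tone music -/

lemma zpow_two_not_between (m : ℤ) : ¬ (1 < (2 : ℝ) ^ m ∧ (2 : ℝ) ^ m < 2) := by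
  rintro ⟨h1, h2⟩
  have h3 : (2 : ℝ) ^ (0 : ℤ) < 2 ^ m := by simpa using h1
  have h4 : (2 : ℝ) ^ m < 2 ^ (1 : ℤ) := by simpa using h2
  rw [zpow_lt_zpow_iff_right₀ one_lt_two] at h3 h4
  omega

lemma one_lt_prod_of_ne_nil {L : List ℝ} (hL : ∀ r ∈ L, 1 < r) (hne : L ≠ []) : 1 < L.prod := by
  induction L with
  | nil => exact absurd rfl hne
  | cons a L ih =>
    rw [List.prod_cons]
    have ha : 1 < a := hL a (by simp)
    by_cases h : L = []
    · simpa [h] using ha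
    · have := ih (fun r hr => hL r (by simp [hr])) h
      nlinarith

/-- For an octave scale the inner partial products lie strictly between 1 and 2, so they are not
powers of 2 and no inner degree is the tonic. -/
lemma prod_take_between {L : List ℝ} (hL : ∀ r ∈ L, 1 < r) {i : ℕ} (h0 : 0 < i)
    (hi : i < L.length) : 1 < (L.take i).prod ∧ (L.take i).prod < L.prod := by
  have h1 : 1 < (L.take i).prod := by
    refine one_lt_prod_of_ne_nil (fun r hr => hL r (List.mem_of_mem_take hr)) fun he => ?_
    rcases List.take_eq_nil_iff.1 he with he | he
    · omega
    · simp [he] at hi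
  have h2 : 1 < (L.drop i).prod := by
    refine one_lt_prod_of_ne_nil (fun r hr => hL r (List.mem_of_mem_drop hr)) fun he => ?_
    have := congrArg List.length he
    simp at this
    omega
  refine ⟨h1, ?_⟩
  rw [← List.prod_take_mul_prod_drop L i]
  nlinarith

lemma prod_map_inv_real (L : List ℝ) : (L.map fun r => r⁻¹).prod = L.prod⁻¹ := by
  induction L with
  | nil => simp
  | cons a L ih => simp [ih, mul_comm]

/-- A heptatonic octave of two equal tetrachords and one step, with steps of one or two consecutive
degrees of magnitude, the last step being a semitone but not the first, and a number of semitones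
divisible by four, consists of twelve semitones. -/
lemma pow_twelve_of_diatonic {ε a b c d : ℝ} {k n : ℤ} (h1 : 1 < ε)
    (hka : a = ε ^ k ∨ a = ε ^ (k + 1)) (hkb : b = ε ^ k ∨ b = ε ^ (k + 1))
    (hkc : c = ε ^ k ∨ c = ε ^ (k + 1)) (hkd : d = ε ^ k ∨ d = ε ^ (k + 1))
    (ha1 : 1 < a) (hb1 : 1 < b) (hd1 : 1 < d) (hc : c = ε) (ha : a ≠ ε)
    (hprod : a * (b * (c * (d * (a * (b * c))))) = 2) (hn : ε ^ (4 * n) = 2) : ε ^ 12 = 2 := by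
  have h0 : 0 < ε := by linarith
  have hinj : ∀ {m n : ℤ}, ε ^ m = ε ^ n → m = n := fun he => zpow_right_injective₀ h0 h1.ne' he
  -- The step `c = ε` leaves only `k = 1` or `k = 0`. In the latter case `a` would be 1 or `ε`, and
  -- both are excluded.
  have hk : k = 1 := by
    rw [hc] at hkc
    rcases hkc with he | he
    · exact (hinj (by rw [zpow_one]; exact he)).symm
    · have hk0 : k + 1 = 1 := (hinj (by rw [zpow_one]; exact he)).symm
      have hk0 : k = 0 := by omega
      subst hk0
      rcases hka with hka | hka
      · rw [zpow_zero] at hka; linarith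
      · rw [zero_add, zpow_one] at hka; exact absurd hka ha
  subst hk
  rw [zpow_one] at hka hkb hkd
  have hka := hka.resolve_left ha
  -- With `a = ε ^ 2` and `c = ε`, the octave has 6 semitones, plus twice the size of `b`, plus the
  -- size of `d`. Sizes 1 or 2 give 9 to 12, and only 12 is divisible by four.
  have key : ∀ N : ℤ, ε ^ N = 2 → 9 ≤ N → N ≤ 12 → ε ^ 12 = 2 := by
    intro N hN h9 h12
    have hNn : N = 4 * n := hinj (hN.trans hn.symm)
    have : N = 12 := by omega
    rw [this] at hN
    exact_mod_cast hN
  subst hka hc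
  norm_num at hkb hkd hprod
  have hcast : ∀ N : ℕ, c ^ N = 2 → c ^ (N : ℤ) = 2 := fun N hN => by exact_mod_cast hN
  rcases hkb with rfl | rfl <;> rcases hkd with rfl | rfl
  · exact key 9 (hcast 9 (by rw [← hprod]; ring)) (by norm_num) (by norm_num)
  · exact key 10 (hcast 10 (by rw [← hprod]; ring)) (by norm_num) (by norm_num)
  · exact key 11 (hcast 11 (by rw [← hprod]; ring)) (by norm_num) (by norm_num)
  · exact key 12 (hcast 12 (by rw [← hprod]; ring)) (by norm_num) (by norm_num)

namespace ToneInterpretation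

variable {M : ToneInterpretation.{u}}

namespace IsModelPITStar

variable (h : M.IsModelPITStar)
include h

/-! ### Equitonal sounds differ by octaves -/

lemma equitonal_equivalence : Equivalence M.equitonal := by
  have hr : ∀ x, M.equitonal x x := fun x =>
    h.tone.tonality_ident x x ((h.pi.ident_iff x x).2 rfl)
  have hs : ∀ {x y}, M.equitonal x y → M.equitonal y x := fun {x y} hxy =>
    h.tone.tonality_euclid y x y (hr y) hxy
  exact ⟨hr, hs, fun {x y z} hxy hyz => h.tone.tonality_euclid x z y hxy (hs hyz)⟩

lemma note_eq_iff (x y : M.Sound) : M.note x = M.note y ↔ M.equitonal x y :=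
  ⟨fun he => h.equitonal_equivalence.eqvGen_iff.1 (Quot.eqvGen_exact he), fun he => Quot.sound he⟩

/-- Uniformity yields an octave with the same pair of pitch classes; since sounds identical in pitch
are equitonal, the property passes to `s` and `m` themselves. -/
lemma isStar_of_frequency {s m : M.Sound} (hsm : M.frequency m = 2 * M.frequency s) :
    M.IsStar s m := by
  have hbase := h.pi.isMeasure_measure.base
  rw [h.pi.measure_eq_div, h.tone.lam_eq_two] at hbase
  have hcong : M.cong (M.interval s m) (M.interval M.x₀ M.y₀) := by
    rw [h.pi.cong_iff, hbase, hsm, mul_div_cancel_right₀ _ (h.pi.frequency_pos s).ne']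
  obtain ⟨s', m', ⟨h1, h2, h3⟩, he⟩ := h.tone.uniformity _ _ h.tone.base_octave _ hcong
  rw [h.pi.interval_eq_iff] at he
  have hE := h.equitonal_equivalence
  have hs : M.equitonal s s' := h.tone.tonality_ident _ _ ((h.pi.ident_iff _ _).2 he.1)
  have hm : M.equitonal m m' := h.tone.tonality_ident _ _ ((h.pi.ident_iff _ _).2 he.2)
  refine ⟨hE.trans hs (hE.trans h1 (hE.symm hm)), ?_, fun x hx hl => ?_⟩
  · rw [h.pi.lower_iff] at *
    rwa [he.1, he.2]
  · have := h3 x (hE.trans (hE.symm hs) hx)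
    rw [h.pi.lower_iff] at *
    rw [← he.1] at this
    rw [he.2]
    rw [h.pi.lower_iff] at this
    exact this hl

lemma equitonal_of_zpow (k : ℤ) : ∀ x y : M.Sound, M.frequency y = 2 ^ k * M.frequency x →
    M.equitonal x y := by
  have hE := h.equitonal_equivalence
  induction k using Int.induction_on with
  | zero =>
    intro x y hxy
    exact h.tone.tonality_ident _ _ ((h.pi.ident_iff _ _).2 (by simpa using hxy.symm))
  | succ n ih =>
    intro x y hxy
    obtain ⟨z, hz⟩ := h.pi.exists_frequency_eq (zpow_pos (two_pos (α := ℝ)) n) x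
    refine hE.trans (ih x z hz) (h.isStar_of_frequency ?_).1
    rw [hxy, hz, zpow_add_one₀ two_ne_zero]
    ring
  | pred n ih =>
    intro x y hxy
    obtain ⟨z, hz⟩ := h.pi.exists_frequency_eq (zpow_pos (two_pos (α := ℝ)) (-n)) x
    refine hE.trans (ih x z hz) (hE.symm (h.isStar_of_frequency ?_).1)
    rw [hxy, hz, zpow_sub_one₀ two_ne_zero]
    ring

lemma equitonal_iff (x y : M.Sound) :
    M.equitonal x y ↔ ∃ k : ℤ, M.frequency y = 2 ^ k * M.frequency x := by
  refine ⟨fun hxy => ?_, fun ⟨k, hk⟩ => h.equitonal_of_zpow k x y hk⟩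
  have hE := h.equitonal_equivalence
  have hx := h.pi.frequency_pos x
  have hy := h.pi.frequency_pos y
  obtain ⟨k, hk1, hk2⟩ := exists_mem_Ico_zpow (div_pos hy hx) (one_lt_two (α := ℝ))
  rw [le_div_iff₀ hx] at hk1
  rw [div_lt_iff₀ hx, zpow_add_one₀ two_ne_zero] at hk2
  refine ⟨k, ?_⟩
  -- Otherwise `y` lies strictly between `z`, which is `k` octaves from `x`, and the octave `m` of
  -- `z`, against the minimality of `m`.
  by_contra hne
  obtain ⟨z, hz⟩ := h.pi.exists_frequency_eq (zpow_pos (two_pos (α := ℝ)) k) x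
  obtain ⟨m, hm⟩ := h.pi.exists_frequency_eq (two_pos (α := ℝ)) z
  refine (h.isStar_of_frequency hm).2.2 y
    (hE.trans (hE.symm (h.equitonal_of_zpow k x z hz)) hxy) ?_ ?_
  · rw [h.pi.lower_iff, hz]
    exact lt_of_le_of_ne hk1 (Ne.symm hne)
  · rw [h.pi.lower_iff, hm, hz]
    linarith

/-! ### The group of harmonic measures -/

lemma exists_harmonic_lower : ∃ a b, M.lower a b ∧ M.harmonic (M.interval a b) := by
  obtain ⟨S, ⟨hlen, -⟩, -⟩ := h.tone.gamme
  obtain ⟨r, hr⟩ := List.exists_mem_of_length_pos (by omega : 0 < S.asc.length)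
  obtain ⟨⟨⟨⟨a⟩, ⟨b⟩⟩, hI, rfl⟩, h1⟩ := S.asc_mem r hr
  exact ⟨a, b, (h.pi.isMeasure_measure.one_lt_iff a b).1 h1, hI⟩

/-- A unison is the sum of a harmonic ascending interval and its conversion. -/
lemma harmonic_of_ident {a b : M.Sound} (hab : M.ident a b) : M.harmonic (M.interval a b) := by
  obtain ⟨c, d, hl, hh⟩ := h.exists_harmonic_lower
  have hn : ¬ M.ident c d := fun hc => hc (Or.inl hl)
  obtain ⟨z, hz⟩ := h.pi.exists_frequency_eq
    (div_pos (h.pi.frequency_pos d) (h.pi.frequency_pos c)) a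
  have ha := (h.pi.frequency_pos a).ne'
  have hc := (h.pi.frequency_pos c).ne'
  have hd := (h.pi.frequency_pos d).ne'
  refine h.tone.harmony_sum c d d c hh (h.tone.harmony_conversion _ _ hn hh) hl (Or.inr hl)
    a z b ?_ ?_
  · rw [h.pi.cong_iff, hz]
    field_simp
  · rw [h.pi.cong_iff, hz, ← (h.pi.ident_iff a b).1 hab]
    field_simp

/-- The axiom covers ascending intervals; descending ones are converted, moved and converted back,
and unisons are always harmonic. -/
lemma harmonic_congr {a b c d : M.Sound} (hc : M.cong (M.interval a b) (M.interval c d))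
    (hh : M.harmonic (M.interval a b)) : M.harmonic (M.interval c d) := by
  have hratio := hc
  rw [h.pi.cong_iff] at hratio
  by_cases hab : M.ident a b
  · rw [h.pi.ident_iff] at hab
    rw [hab, div_self (h.pi.frequency_pos b).ne', eq_comm,
      div_eq_one_iff_eq (h.pi.frequency_pos c).ne'] at hratio
    exact h.harmonic_of_ident ((h.pi.ident_iff c d).2 hratio.symm)
  by_cases hl : M.lower a b
  · exact h.tone.harmony_cong a b c d hl hc hh
  have hl' : M.lower b a := by
    by_contra hn
    exact hab (fun ho => ho.elim hl hn)
  have hc' : M.cong (M.interval b a) (M.interval d c) := by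
    rw [h.pi.cong_iff, ← inv_div, hratio, inv_div]
  refine h.tone.harmony_conversion d c (fun hdc => ?_)
    (h.tone.harmony_cong b a d c hl' hc' (h.tone.harmony_conversion a b hab hh))
  exact hdc (Or.inl (h.pi.intervals.regularity_lower _ _ _ _ hl' hc'))

lemma harmonic_iff_mem (a b : M.Sound) : M.harmonic (M.interval a b) ↔
    M.frequency b / M.frequency a ∈ M.harmonicMeasures := by
  rw [← h.pi.measure_eq_div]
  refine ⟨fun hh => ⟨_, hh, rfl⟩, ?_⟩
  rintro ⟨⟨⟨c⟩, ⟨d⟩⟩, hh, he⟩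
  exact h.harmonic_congr ((h.pi.isMeasure_measure.eq_iff _ _).1 he) hh

lemma pos_of_mem {r : ℝ} (hr : r ∈ M.harmonicMeasures) : 0 < r := by
  obtain ⟨I, -, rfl⟩ := hr
  exact h.pi.isMeasure_measure.pos I

lemma mem_iff {r : ℝ} (a b : M.Sound) (hb : M.frequency b = r * M.frequency a) :
    r ∈ M.harmonicMeasures ↔ M.harmonic (M.interval a b) := by
  rw [h.harmonic_iff_mem, hb, mul_div_cancel_right₀ _ (h.pi.frequency_pos a).ne']

lemma one_mem : 1 ∈ M.harmonicMeasures :=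
  (h.mem_iff M.x₀ M.x₀ (one_mul _).symm).2
    (h.harmonic_of_ident ((h.pi.ident_iff _ _).2 rfl))

lemma inv_mem {r : ℝ} (hr : r ∈ M.harmonicMeasures) : r⁻¹ ∈ M.harmonicMeasures := by
  have hpos := h.pos_of_mem hr
  obtain ⟨b, hb⟩ := h.pi.exists_frequency_eq hpos M.x₀
  have hh := (h.mem_iff _ _ hb).1 hr
  rw [h.mem_iff b M.x₀ (by rw [hb, inv_mul_cancel_left₀ hpos.ne'])]
  by_cases hi : M.ident M.x₀ b
  · exact h.harmonic_of_ident (h.pi.pitch.ident_equivalence.symm hi)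
  · exact h.tone.harmony_conversion _ _ hi hh

lemma mul_mem_of_one_lt {r s : ℝ} (hr : r ∈ M.harmonicMeasures) (hs : s ∈ M.harmonicMeasures)
    (hr1 : 1 < r) : r * s ∈ M.harmonicMeasures := by
  have hr0 := h.pos_of_mem hr
  have hs0 := h.pos_of_mem hs
  obtain ⟨b, hb⟩ := h.pi.exists_frequency_eq hr0 M.x₀
  obtain ⟨c, hc⟩ := h.pi.exists_frequency_eq hs0 b
  have hh := (h.mem_iff _ _ hb).1 hr
  have hh' := (h.mem_iff _ _ hc).1 hs
  by_cases hi : M.ident b c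
  · rw [h.pi.ident_iff, hc] at hi
    have : s = 1 := by
      have := (h.pi.frequency_pos b).ne'
      exact mul_right_cancel₀ this (by rw [← hi, one_mul])
    rwa [this, mul_one]
  · have hl : M.lower M.x₀ b := by
      rw [h.pi.lower_iff, hb]
      nlinarith [h.pi.frequency_pos M.x₀]
    rw [h.mem_iff M.x₀ c (by rw [hc, hb]; ring)]
    exact h.tone.harmony_sum _ _ _ _ hh hh' hl (not_not.1 hi) M.x₀ b c
      (h.pi.intervals.cong_refl _) (h.pi.intervals.cong_refl _)

lemma mul_mem {r s : ℝ} (hr : r ∈ M.harmonicMeasures) (hs : s ∈ M.harmonicMeasures) :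
    r * s ∈ M.harmonicMeasures := by
  rcases lt_trichotomy r 1 with hl | rfl | hl
  -- The sum axiom wants a first summand greater than unit, so a factor below 1 is treated through
  -- inverses.
  · have := h.mul_mem_of_one_lt (h.inv_mem hr) (h.inv_mem hs)
      ((one_lt_inv₀ (h.pos_of_mem hr)).2 hl)
    rw [← mul_inv] at this
    simpa using h.inv_mem this
  · rwa [one_mul]
  · exact h.mul_mem_of_one_lt hr hs hl

/-- The harmonic measures are the integral powers of the semitone. -/
lemma harmonicMeasures_eq : 1 < M.semitone ∧
    ∀ r, r ∈ M.harmonicMeasures ↔ ∃ k : ℤ, r = M.semitone ^ k := by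
  -- In logarithms the harmonic measures are a subgroup of the reals; diatonicism leaves a gap above
  -- 0, so it is cyclic, generated by its least positive element.
  let A : AddSubgroup ℝ :=
    { carrier := {t | Real.exp t ∈ M.harmonicMeasures}
      zero_mem' := by simpa using h.one_mem
      add_mem' := fun {a b} ha hb => by
        simp only [Set.mem_ofPred_eq, Real.exp_add] at *
        exact h.mul_mem ha hb
      neg_mem' := fun {a} ha => by
        simp only [Set.mem_ofPred_eq, Real.exp_neg] at *
        exact h.inv_mem ha }
  have hA : ∀ t, t ∈ A ↔ Real.exp t ∈ M.harmonicMeasures := fun t => Iff.rfl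
  have hlog : ∀ r ∈ M.harmonicMeasures, Real.log r ∈ A := fun r hr => by
    rwa [hA, Real.exp_log (h.pos_of_mem hr)]
  obtain ⟨α, hα, hd⟩ := h.tone.diatonicism
  have hbot : A ≠ ⊥ := by
    obtain ⟨a, b, hl, hh⟩ := h.exists_harmonic_lower
    intro hb
    have h1 := hlog _ ((h.harmonic_iff_mem a b).1 hh)
    rw [hb, AddSubgroup.mem_bot] at h1
    rw [h.pi.lower_iff, ← one_lt_div (h.pi.frequency_pos a)] at hl
    exact (Real.log_pos hl).ne' h1
  have hdis : Disjoint (A : Set ℝ) (Set.Ioo 0 (Real.log α)) := by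
    rw [Set.disjoint_left]
    rintro t ht ⟨h1, h2⟩
    exact hd _ (Real.one_lt_exp_iff.2 h1) ⟨(Real.lt_log_iff_exp_lt (by linarith)).1 h2, ht⟩
  obtain ⟨b, hb⟩ := AddSubgroup.exists_isLeast_pos hbot (Real.log_pos hα) hdis
  have hcyc := AddSubgroup.cyclic_of_min hb
  have hsemi : M.semitone = Real.exp b := by
    refine IsLeast.csInf_eq ⟨⟨hb.1.1, Real.one_lt_exp_iff.2 hb.1.2⟩, ?_⟩
    rintro r ⟨hr, h1⟩
    rw [← Real.le_log_iff_exp_le (by linarith)]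
    exact hb.2 ⟨hlog r hr, Real.log_pos h1⟩
  have hpow : ∀ k : ℤ, M.semitone ^ k = Real.exp (k • b) := fun k => by
    rw [hsemi, zsmul_eq_mul, mul_comm, Real.exp_mul, Real.rpow_intCast]
  refine ⟨hsemi ▸ Real.one_lt_exp_iff.2 hb.1.2, fun r => ⟨fun hr => ?_, ?_⟩⟩
  · have := hlog r hr
    rw [hcyc, AddSubgroup.mem_closure_singleton] at this
    obtain ⟨k, hk⟩ := this
    exact ⟨k, by rw [hpow, hk, Real.exp_log (h.pos_of_mem hr)]⟩
  · rintro ⟨k, rfl⟩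
    rw [hpow, ← hA]
    exact A.zsmul_mem hb.1.1 k

/-! ### Tetrachords and the number of semitones in an octave -/

lemma exists_degree (κ : M.Note) {L : List ℝ} {i : ℕ} (hpos : 0 < (L.take i).prod)
    (hpow : ∀ m : ℤ, (L.take i).prod ≠ 2 ^ m) : ∃ ν, M.IsDegree κ L i ν ∧ ν ≠ κ := by
  obtain ⟨s, rfl⟩ := Quot.exists_rep κ
  obtain ⟨t, ht⟩ := h.pi.exists_frequency_eq hpos s
  refine ⟨M.note t, ⟨s, t, rfl, by rw [ht, mul_comm], rfl⟩, fun he => ?_⟩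
  obtain ⟨k, hk⟩ := (h.equitonal_iff s t).1 ((h.note_eq_iff s t).1 he.symm)
  rw [ht] at hk
  exact hpow k (mul_right_cancel₀ (h.pi.frequency_pos s).ne' hk)

/-- Groups of four degrees that meet at most in the tonic are the outer ones. -/
lemma degrees_separate (κ : M.Note) {L : List ℝ}
    (hL : ∀ i, 0 < i → i < 7 → 0 < (L.take i).prod ∧ ∀ m : ℤ, (L.take i).prod ≠ 2 ^ m)
    {j j' : ℕ} (hjj : j ≤ j') (hj' : j' + 3 ≤ 7)
    (hC : M.degrees κ L j (j + 3) ∩ M.degrees κ L j' (j' + 3) ⊆ {κ}) : j = 0 ∧ j' = 4 := by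
  by_contra hn
  -- Unless the groups start at 0 and 4, the index `max j' 1` belongs to both; the 1 avoids index 0,
  -- which is the tonic.
  obtain ⟨h1, h2⟩ := hL (max j' 1) (by omega) (by omega)
  obtain ⟨ν, hν, hne⟩ := h.exists_degree κ h1 h2
  exact hne (hC ⟨⟨_, by omega, by omega, hν⟩, ⟨_, by omega, by omega, hν⟩⟩)

lemma tetrachord_eq {L : List ℝ} (κ : M.Note) (hlen : L.length = 7)
    (hL : ∀ i, 0 < i → i < 7 → 0 < (L.take i).prod ∧ ∀ m : ℤ, (L.take i).prod ≠ 2 ^ m)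
    {j j' : ℕ} (hj : j + 3 ≤ L.length) (hj' : j' + 3 ≤ L.length)
    (he : (L.drop j).take 3 = (L.drop j').take 3)
    (hC : M.degrees κ L j (j + 3) ∩ M.degrees κ L j' (j' + 3) ⊆ {κ}) :
    L.take 3 = (L.drop 4).take 3 := by
  rcases le_total j j' with hjj | hjj
  · obtain ⟨rfl, rfl⟩ := h.degrees_separate κ hL hjj (by omega) hC
    exact he
  · rw [Set.inter_comm] at hC
    obtain ⟨rfl, rfl⟩ := h.degrees_separate κ hL hjj (by omega) hC
    exact he.symm

/-- An ascending and a descending tetrachord are never equal, as their steps lie on different sides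
of 1. Two descending ones give the ascending equality by inverting and reversing. -/
lemma tetrachord_asc {S : M.Scale} (hlen : S.asc.length = 7) (hcomp : S.Compatible)
    (ht : S.HasDisjointEqualTetrachords) : S.asc.take 3 = (S.asc.drop 4).take 3 := by
  have hasc : ∀ i, 0 < i → i < 7 →
      0 < (S.asc.take i).prod ∧ ∀ m : ℤ, (S.asc.take i).prod ≠ 2 ^ m := by
    intro i h0 hi
    have hb := prod_take_between (fun r hr => (S.asc_mem r hr).2) h0 (by omega)
    rw [S.asc_prod] at hb
    exact ⟨by linarith, fun m hm => zpow_two_not_between m (hm ▸ hb)⟩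
  have hdesc : ∀ i, 0 < i → i < 7 →
      0 < (S.desc.take i).prod ∧ ∀ m : ℤ, (S.desc.take i).prod ≠ 2 ^ m := by
    intro i h0 hi
    have hb := prod_take_between (L := S.asc.reverse)
      (fun r hr => (S.asc_mem r (List.mem_reverse.1 hr)).2) h0 (by simpa [hlen] using hi)
    rw [List.prod_reverse, S.asc_prod] at hb
    rw [hcomp, ← List.map_reverse, ← List.map_take, prod_map_inv_real]
    refine ⟨by have := hb.1; positivity, fun m hm => zpow_two_not_between (-m) ?_⟩
    rw [zpow_neg, ← hm, inv_inv]
    exact hb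
  have hdlen : S.desc.length = 7 := by rw [hcomp]; simpa using hlen
  have hmixed : ∀ {j j' : ℕ}, j + 3 ≤ S.asc.length →
      (S.asc.drop j).take 3 ≠ (S.desc.drop j').take 3 := by
    intro j j' hj he
    obtain ⟨r, hr⟩ := List.exists_mem_of_length_pos (l := (S.asc.drop j).take 3)
      (by simp; omega)
    have h1 := (S.asc_mem r (List.mem_of_mem_drop (List.mem_of_mem_take hr))).2
    rw [he] at hr
    have h2 := (S.desc_mem r (List.mem_of_mem_drop (List.mem_of_mem_take hr))).2
    linarith
  obtain ⟨τ, C, D, ⟨j, hj, h1, rfl⟩ | ⟨j, hj, h1, rfl⟩,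
    ⟨j', hj', h2, rfl⟩ | ⟨j', hj', h2, rfl⟩, hCD⟩ := ht
  · exact h.tetrachord_eq S.tonic hlen hasc hj hj' (h1.symm.trans h2) hCD
  · exact absurd (h1.symm.trans h2) (hmixed hj)
  · exact absurd (h2.symm.trans h1) (hmixed hj')
  · have he := h.tetrachord_eq S.tonic hdlen hdesc hj hj' (h1.symm.trans h2) hCD
    rw [hcomp] at he
    obtain ⟨a, b, c, d, e, f, g, hl⟩ : ∃ a b c d e f g, S.asc = [a, b, c, d, e, f, g] := by
      match hS : S.asc, hlen with
      | [a, b, c, d, e, f, g], _ => exact ⟨a, b, c, d, e, f, g, rfl⟩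
    rw [hl] at he ⊢
    simp at he ⊢
    exact ⟨he.2.2.symm, he.2.1.symm, he.1.symm⟩

/-- The octave consists of twelve semitones. -/
theorem semitone_pow_twelve : M.semitone ^ 12 = 2 := by
  obtain ⟨h1, hH⟩ := h.harmonicMeasures_eq
  set ε := M.semitone with hε
  have h0 : 0 < ε := by linarith
  obtain ⟨S, ⟨hlen, -⟩, hcomp, heven, hlast, hnlast, htet, x, y, z, htri, -⟩ := h.tone.gamme
  have htet' := h.tetrachord_asc hlen hcomp htet
  -- If the descending mode is the maximally even one, inversion turns the exponents `k`, `k + 1`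
  -- into `-k`, `-k - 1`.
  obtain ⟨k, hk⟩ : ∃ k : ℤ, ∀ r ∈ S.asc, r = ε ^ k ∨ r = ε ^ (k + 1) := by
    rcases heven with hm | ⟨k, hk⟩
    · exact hm
    · refine ⟨-k - 1, fun r hr => ?_⟩
      have := hk r⁻¹ (by rw [hcomp]; simpa using hr)
      rw [inv_eq_iff_eq_inv, inv_eq_iff_eq_inv, ← zpow_neg, ← zpow_neg] at this
      rw [show -k - 1 = -(k + 1) by ring, show -(k + 1) + 1 = -k by ring]
      exact this.symm
  have hgt : ∀ r ∈ S.asc, 1 < r := fun r hr => (S.asc_mem r hr).2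
  have hprod := S.asc_prod
  -- In the major triad the lower third is `ε` times the upper one, so the fifth `ε * √2` is `ε`
  -- times the square of the upper third `ε ^ n`. Thus `√2 = ε ^ (2 * n)`.
  obtain ⟨n, hn⟩ : ∃ n : ℤ, ε ^ (4 * n) = 2 := by
    obtain ⟨-, hyz, hxy, -, hxz⟩ := htri
    obtain ⟨n, hn⟩ := (hH _).1 ⟨_, hyz.2, rfl⟩
    refine ⟨n, ?_⟩
    rw [h.pi.isMeasure_measure.mul x y z, hxy, hn, mul_assoc, mul_right_inj' h0.ne'] at hxz
    rw [mul_comm, zpow_mul]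
    have h2 : (√2 : ℝ) ^ 2 = 2 := Real.sq_sqrt (by norm_num)
    rw [← hxz] at h2
    rw [← h2]
    norm_cast
    ring
  have hdl : S.desc.getLast? ≠ some ε⁻¹ := hnlast
  have hal : S.asc.getLast? = some ε := hlast
  obtain ⟨a, b, c, d, e, f, g, hl⟩ : ∃ a b c d e f g, S.asc = [a, b, c, d, e, f, g] := by
    match hS : S.asc, hlen with
    | [a, b, c, d, e, f, g], _ => exact ⟨a, b, c, d, e, f, g, rfl⟩
  rw [hcomp, hl] at hdl
  rw [hl] at hal htet' hk hgt hprod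
  simp only [List.mem_cons, List.not_mem_nil, or_false, forall_eq_or_imp, forall_eq,
    List.prod_cons, List.prod_nil, mul_one] at hk hgt hprod
  have hg : g = ε := by simpa using hal
  -- The last descending step is the inverse of the first ascending one.
  have ha : a ≠ ε := by simpa using hdl
  have ht : a = e ∧ b = f ∧ c = g := by simpa using htet'
  exact pow_twelve_of_diatonic h1 hk.1 hk.2.1 hk.2.2.1 hk.2.2.2.1 hgt.1 hgt.2.1 hgt.2.2.2.1
    (by rw [← hg, ht.2.2]) ha (by rw [← hprod, ← ht.1, ← ht.2.1, ← ht.2.2]) hn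

end IsModelPITStar
end ToneInterpretation

namespace ToneInterpretation

/-- Both semitones are the positive twelfth root of 2, so harmonicity is the same condition on
frequency quotients in both models. -/
theorem isToneIso_timbreEquiv {M₁ : ToneInterpretation.{v}} {M₂ : ToneInterpretation.{w}}
    (h₁ : M₁.IsModelPITStar) (h₂ : M₂.IsModelPITStar) :
    IsToneIso M₁ M₂ (h₁.pi.timbreEquiv.trans h₂.pi.timbreEquiv.symm) := by
  have hiso := Interpretation.isIso_timbreEquiv h₁.pi h₂.pi
  have hε : M₁.semitone = M₂.semitone :=
    (pow_left_inj₀ (by linarith [h₁.harmonicMeasures_eq.1])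
      (by linarith [h₂.harmonicMeasures_eq.1]) (by norm_num)).1
      (h₁.semitone_pow_twelve.trans h₂.semitone_pow_twelve.symm)
  refine ⟨hiso, fun x y => ?_, fun a b => ?_⟩
  · rw [h₁.equitonal_iff, h₂.equitonal_iff, hiso.frequency_eq, hiso.frequency_eq]
  · rw [h₁.harmonic_iff_mem, h₂.harmonic_iff_mem, hiso.frequency_eq, hiso.frequency_eq,
      h₁.harmonicMeasures_eq.2, h₂.harmonicMeasures_eq.2, hε]

/-! ### The twelve-tone model -/

/-- Tone music in which the semitone is the twelfth part of the octave, equitonal sounds differ by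
octaves, and the harmonic intervals are the multiples of the semitone. -/
structure IsTwelveTone (M : ToneInterpretation.{u}) (ε : ℝ) : Prop where
  pi : M.IsModelPIStar
  lam_eq_two : M.lam = 2
  one_lt : 1 < ε
  pow_twelve : ε ^ 12 = 2
  equitonal_iff : ∀ x y, M.equitonal x y ↔ ∃ k : ℤ, M.frequency y = 2 ^ k * M.frequency x
  harmonic_iff : ∀ a b, M.harmonic (M.interval a b) ↔
    ∃ k : ℤ, M.frequency b = ε ^ k * M.frequency a

namespace IsTwelveTone

variable {M : ToneInterpretation.{u}} {ε : ℝ} (h : M.IsTwelveTone ε)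
include h

lemma pos : 0 < ε := by linarith [h.one_lt]

lemma measure_eq_iff (a b : M.Sound) (r : ℝ) :
    M.measure (M.interval a b) = r ↔ M.frequency b = r * M.frequency a := by
  rw [h.pi.measure_eq_div, div_eq_iff (h.pi.frequency_pos a).ne']

lemma mem_iff (r : ℝ) : r ∈ M.harmonicMeasures ↔ ∃ k : ℤ, r = ε ^ k := by
  constructor
  · rintro ⟨⟨⟨a⟩, ⟨b⟩⟩, hh, rfl⟩
    obtain ⟨k, hk⟩ := (h.harmonic_iff a b).1 hh
    exact ⟨k, (h.measure_eq_iff a b _).2 hk⟩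
  · rintro ⟨k, rfl⟩
    obtain ⟨b, hb⟩ := h.pi.exists_frequency_eq (zpow_pos h.pos k) M.x₀
    exact ⟨M.interval M.x₀ b, (h.harmonic_iff _ _).2 ⟨k, hb⟩, (h.measure_eq_iff _ _ _).2 hb⟩

lemma semitone_le {r : ℝ} (hr : r ∈ M.harmonicMeasures) (h1 : 1 < r) : ε ≤ r := by
  obtain ⟨k, rfl⟩ := (h.mem_iff r).1 hr
  have hk : ε ^ (0 : ℤ) < ε ^ k := by simpa using h1
  rw [zpow_lt_zpow_iff_right₀ h.one_lt] at hk
  have : ε ^ (1 : ℤ) ≤ ε ^ k := (zpow_le_zpow_iff_right₀ h.one_lt).2 hk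
  simpa using this

lemma pow_mem (n : ℕ) : ε ^ n ∈ M.harmonicMeasures := (h.mem_iff _).2 ⟨n, (zpow_natCast _ _).symm⟩

lemma inv_pow_mem (n : ℕ) : (ε ^ n)⁻¹ ∈ M.harmonicMeasures :=
  (h.mem_iff _).2 ⟨-n, by rw [zpow_neg, zpow_natCast]⟩

lemma semitone_eq : M.semitone = ε :=
  IsLeast.csInf_eq ⟨⟨by simpa using h.pow_mem 1, h.one_lt⟩, fun _ hr => h.semitone_le hr.1 hr.2⟩

lemma zpow_twelve_mul (k : ℤ) : ε ^ (12 * k) = 2 ^ k := by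
  rw [zpow_mul]
  congr 1
  exact_mod_cast h.pow_twelve

lemma equitonal_equivalence : Equivalence M.equitonal where
  refl x := (h.equitonal_iff x x).2 ⟨0, by simp⟩
  symm {x y} hxy := by
    obtain ⟨k, hk⟩ := (h.equitonal_iff x y).1 hxy
    refine (h.equitonal_iff y x).2 ⟨-k, ?_⟩
    rw [hk, zpow_neg, inv_mul_cancel_left₀ (zpow_ne_zero _ two_ne_zero)]
  trans {x y z} hxy hyz := by
    obtain ⟨k, hk⟩ := (h.equitonal_iff x y).1 hxy
    obtain ⟨l, hl⟩ := (h.equitonal_iff y z).1 hyz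
    refine (h.equitonal_iff x z).2 ⟨l + k, ?_⟩
    rw [hl, hk, zpow_add₀ two_ne_zero, mul_assoc]

lemma note_eq_iff (x y : M.Sound) : M.note x = M.note y ↔ M.equitonal x y :=
  ⟨fun he => h.equitonal_equivalence.eqvGen_iff.1 (Quot.eqvGen_exact he), fun he => Quot.sound he⟩

lemma isStar_iff (s m : M.Sound) : M.IsStar s m ↔ M.frequency m = 2 * M.frequency s := by
  have hs := h.pi.frequency_pos s
  have hup : ∀ x, M.equitonal s x → M.lower s x → 2 * M.frequency s ≤ M.frequency x := by
    intro x hx hl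
    obtain ⟨k, hk⟩ := (h.equitonal_iff s x).1 hx
    rw [h.pi.lower_iff, hk] at hl
    have h1 : (2 : ℝ) ^ (0 : ℤ) < 2 ^ k := by
      rw [zpow_zero]
      exact lt_of_mul_lt_mul_right (by linarith) hs.le
    rw [zpow_lt_zpow_iff_right₀ one_lt_two] at h1
    have h2 : (2 : ℝ) ^ (1 : ℤ) ≤ 2 ^ k := (zpow_le_zpow_iff_right₀ one_lt_two).2 h1
    rw [zpow_one] at h2
    rw [hk]
    exact mul_le_mul_of_nonneg_right h2 hs.le
  constructor
  · rintro ⟨h1, h2, h3⟩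
    obtain ⟨x, hx⟩ := h.pi.exists_frequency_eq (two_pos (α := ℝ)) s
    have := h3 x ((h.equitonal_iff s x).2 ⟨1, by rw [hx, zpow_one]⟩)
      ((h.pi.lower_iff s x).2 (by linarith))
    rw [h.pi.lower_iff, hx] at this
    exact le_antisymm (not_lt.1 this) (hup m h1 h2)
  · intro hm
    refine ⟨(h.equitonal_iff s m).2 ⟨1, by rw [hm, zpow_one]⟩,
      (h.pi.lower_iff s m).2 (by linarith), fun x hx hl => ?_⟩
    rw [h.pi.lower_iff, hm]
    exact not_lt.2 (hup x hx hl)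

/-- The scale with the steps tone, tone, semitone, tone, tone, tone, semitone. -/
def majorScale : M.Scale where
  tonic := M.note M.x₀
  asc := [ε ^ 2, ε ^ 2, ε ^ 1, ε ^ 2, ε ^ 2, ε ^ 2, ε ^ 1]
  desc := [(ε ^ 1)⁻¹, (ε ^ 2)⁻¹, (ε ^ 2)⁻¹, (ε ^ 2)⁻¹, (ε ^ 1)⁻¹, (ε ^ 2)⁻¹, (ε ^ 2)⁻¹]
  asc_mem r hr := by
    have h1 : ∀ n : ℕ, n ≠ 0 → ε ^ n ∈ M.harmonicMeasures ∧ 1 < ε ^ n := fun n hn =>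
      ⟨h.pow_mem n, one_lt_pow₀ h.one_lt hn⟩
    simp only [List.mem_cons, List.not_mem_nil, or_false] at hr
    rcases hr with rfl | rfl | rfl | rfl | rfl | rfl | rfl <;> exact h1 _ (by norm_num)
  desc_mem r hr := by
    have h1 : ∀ n : ℕ, n ≠ 0 → (ε ^ n)⁻¹ ∈ M.harmonicMeasures ∧ (ε ^ n)⁻¹ < 1 := fun n hn =>
      ⟨h.inv_pow_mem n, inv_lt_one_of_one_lt₀ (one_lt_pow₀ h.one_lt hn)⟩
    simp only [List.mem_cons, List.not_mem_nil, or_false] at hr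
    rcases hr with rfl | rfl | rfl | rfl | rfl | rfl | rfl <;> exact h1 _ (by norm_num)
  asc_prod := by
    rw [← h.pow_twelve]
    simp only [List.prod_cons, List.prod_nil]
    ring
  desc_prod := by
    rw [one_div, ← h.pow_twelve]
    simp only [List.prod_cons, List.prod_nil, ← mul_inv, mul_one]
    congr 1
    ring

/-- Any representative of the tonic differs from the base sound by octaves, which do not change the
note reached. -/
lemma isDegree_iff (L : List ℝ) (i n : ℕ) (hn : (L.take i).prod = ε ^ n) (ν : M.Note) :
    M.IsDegree (M.note M.x₀) L i ν ↔
      ∃ t, M.frequency t = ε ^ n * M.frequency M.x₀ ∧ M.note t = ν := by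
  constructor
  · rintro ⟨s, t, hs, ht, rfl⟩
    obtain ⟨k, hk⟩ := (h.equitonal_iff _ _).1 ((h.note_eq_iff _ _).1 hs)
    obtain ⟨t', ht'⟩ := h.pi.exists_frequency_eq (pow_pos h.pos n) M.x₀
    refine ⟨t', ht', (h.note_eq_iff _ _).2 ((h.equitonal_iff _ _).2 ⟨-k, ?_⟩)⟩
    rw [ht, ht', hk, hn, zpow_neg]
    have : (2 : ℝ) ^ k ≠ 0 := zpow_ne_zero _ two_ne_zero
    field_simp
  · rintro ⟨t, ht, rfl⟩
    exact ⟨M.x₀, t, rfl, by rw [ht, hn, mul_comm], rfl⟩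

/-- In semitones above the tonic the two groups of degrees are 0, 2, 4, 5 and 7, 9, 11, 12. Modulo
12 they share only the tonic. -/
lemma majorScale_disjoint : h.majorScale.HasDisjointEqualTetrachords := by
  refine ⟨[ε ^ 2, ε ^ 2, ε ^ 1], _, _, Or.inl ⟨0, by simp [majorScale], rfl, rfl⟩,
    Or.inl ⟨4, by simp [majorScale], rfl, rfl⟩, ?_⟩
  rintro ν ⟨⟨i, -, hi, hν⟩, ⟨j, hj1, hj2, hν'⟩⟩
  have key : ∀ m n : ℕ, m ≤ 5 → 7 ≤ n → n ≤ 12 →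
      (h.majorScale.asc.take i).prod = ε ^ m → (h.majorScale.asc.take j).prod = ε ^ n →
      ν ∈ ({h.majorScale.tonic} : Set M.Note) := by
    intro m n hm hn hn' hpm hpn
    obtain ⟨s, hs, rfl⟩ := (h.isDegree_iff _ _ _ hpm ν).1 hν
    obtain ⟨t, ht, hst⟩ := (h.isDegree_iff _ _ _ hpn _).1 hν'
    obtain ⟨k, hk⟩ := (h.equitonal_iff _ _).1 ((h.note_eq_iff _ _).1 hst.symm)
    rw [ht, hs, ← h.zpow_twelve_mul, ← mul_assoc] at hk
    have he := mul_right_cancel₀ (h.pi.frequency_pos M.x₀).ne' hk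
    rw [← zpow_natCast, ← zpow_natCast, ← zpow_add₀ h.pos.ne'] at he
    have he' : (n : ℤ) = 12 * k + m := zpow_right_injective₀ h.pos h.one_lt.ne' he
    have hm0 : m = 0 := by omega
    subst hm0
    refine (h.note_eq_iff _ _).2 ((h.equitonal_iff _ _).2 ⟨0, ?_⟩)
    rw [hs]
    simp
  have hi' : ∃ m ≤ 5, (h.majorScale.asc.take i).prod = ε ^ m := by
    interval_cases i
    · exact ⟨0, by norm_num, by simp⟩
    · exact ⟨2, by norm_num, by simp [majorScale]⟩
    · exact ⟨4, by norm_num, by simp [majorScale]; ring⟩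
    · exact ⟨5, by norm_num, by simp [majorScale]; ring⟩
  have hj' : ∃ n, 7 ≤ n ∧ n ≤ 12 ∧ (h.majorScale.asc.take j).prod = ε ^ n := by
    interval_cases j
    · exact ⟨7, by norm_num, by norm_num, by simp [majorScale]; ring⟩
    · exact ⟨9, by norm_num, by norm_num, by simp [majorScale]; ring⟩
    · exact ⟨11, by norm_num, by norm_num, by simp [majorScale]; ring⟩
    · exact ⟨12, by norm_num, by norm_num, by simp [majorScale]; ring⟩
  obtain ⟨m, hm, hpm⟩ := hi'
  obtain ⟨n, hn, hn', hpn⟩ := hj'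
  exact key m n hm hn hn' hpm hpn

/-- The triad has 4 and 3 semitones. Its fifth has 7 = 1 + 6 of them, with `ε ^ 6 = √2`, and its
notes are reached after 0, 2 and 4 steps of the scale. -/
lemma majorScale_triad : ∃ x y z, M.IsMajorTriad x y z ∧
    M.ScaleBasedOnTonic h.majorScale x y z := by
  obtain ⟨y, hy⟩ := h.pi.exists_frequency_eq (pow_pos h.pos 4) M.x₀
  obtain ⟨z, hz⟩ := h.pi.exists_frequency_eq (pow_pos h.pos 3) y
  have hxy := (h.measure_eq_iff _ _ _).2 hy
  have hyz := (h.measure_eq_iff _ _ _).2 hz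
  have hxz : M.measure (M.interval M.x₀ z) = ε ^ 7 := by
    rw [h.measure_eq_iff, hz, hy]
    ring
  have hdyad : ∀ (a b : M.Sound) (n : ℕ), n ≠ 0 → M.measure (M.interval a b) = ε ^ n →
      M.IsDyad a b := by
    intro a b n hn hab
    refine ⟨(h.pi.isMeasure_measure.one_lt_iff a b).1 (hab ▸ one_lt_pow₀ h.one_lt hn),
      (h.harmonic_iff a b).2 ⟨n, ?_⟩⟩
    rw [zpow_natCast]
    exact (h.measure_eq_iff _ _ _).1 hab
  refine ⟨M.x₀, y, z, ⟨hdyad _ _ 4 (by norm_num) hxy, hdyad _ _ 3 (by norm_num) hyz, ?_,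
    hdyad _ _ 7 (by norm_num) hxz, ?_⟩, ?_⟩
  · rw [hxy, hyz, h.semitone_eq]
    ring
  · have hsqrt : √2 = ε ^ 6 := by
      rw [Real.sqrt_eq_iff_mul_self_eq (by norm_num) (pow_nonneg h.pos.le 6), ← h.pow_twelve]
      ring
    rw [hxz, h.semitone_eq, hsqrt]
    ring
  · rw [ScaleBasedOnTonic, hxy, hyz]
    rintro ν ⟨k, -, hk, hν⟩
    have key : ∀ n j : ℕ, j ≤ 7 → (([ε ^ 4, ε ^ 3] : List ℝ).take k).prod = ε ^ n →
        (h.majorScale.asc.take j).prod = ε ^ n →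
        ν ∈ M.components h.majorScale.tonic h.majorScale.asc := by
      intro n j hj h1 h2
      exact ⟨j, Nat.zero_le _, hj,
        (h.isDegree_iff _ _ _ h2 ν).2 ((h.isDegree_iff _ _ _ h1 ν).1 hν)⟩
    change k ≤ 2 at hk
    interval_cases k
    · exact key 0 0 (by norm_num) (by simp) (by simp)
    · exact key 4 2 (by norm_num) (by simp) (by simp [majorScale]; ring)
    · exact key 7 4 (by norm_num) (by simp; ring) (by simp [majorScale]; ring)

theorem toneAxioms : M.ToneAxioms where
  tonality_ident x y hxy := (h.equitonal_iff x y).2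
    ⟨0, by rw [(h.pi.ident_iff x y).1 hxy, zpow_zero, one_mul]⟩
  tonality_euclid x y z hxz hyz :=
    h.equitonal_equivalence.trans hxz (h.equitonal_equivalence.symm hyz)
  base_octave := by
    rw [h.isStar_iff, ← h.measure_eq_iff, h.pi.isMeasure_measure.base, h.lam_eq_two]
  lam_eq_two := h.lam_eq_two
  uniformity s m hsm := by
    rintro ⟨⟨a⟩, ⟨b⟩⟩ hI
    refine ⟨a, b, ?_, rfl⟩
    have hc := (h.pi.isMeasure_measure.eq_iff _ _).2 hI
    rw [h.isStar_iff, ← h.measure_eq_iff] at *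
    exact hc.trans hsm
  harmony_cong a b c d _ hc hh := by
    rw [h.harmonic_iff] at *
    obtain ⟨k, hk⟩ := hh
    refine ⟨k, ?_⟩
    rw [← h.measure_eq_iff] at *
    rw [← hk]
    exact ((h.pi.isMeasure_measure.eq_iff _ _).2 hc).symm
  harmony_conversion a b _ hh := by
    obtain ⟨k, hk⟩ := (h.harmonic_iff a b).1 hh
    refine (h.harmonic_iff b a).2 ⟨-k, ?_⟩
    rw [hk, zpow_neg, inv_mul_cancel_left₀ (zpow_ne_zero _ h.pos.ne')]
  harmony_sum a b c d hab hcd _ _ x z y hxz hzy := by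
    obtain ⟨k, hk⟩ := (h.harmonic_iff a b).1 hab
    obtain ⟨l, hl⟩ := (h.harmonic_iff c d).1 hcd
    rw [← h.measure_eq_iff] at hk hl
    rw [← h.pi.isMeasure_measure.eq_iff, hk, h.measure_eq_iff] at hxz
    rw [← h.pi.isMeasure_measure.eq_iff, hl, h.measure_eq_iff] at hzy
    refine (h.harmonic_iff x y).2 ⟨l + k, ?_⟩
    rw [hzy, hxz, zpow_add₀ h.pos.ne', mul_assoc]
  diatonicism := ⟨ε, h.one_lt, fun _ h1 hβ => absurd (h.semitone_le hβ.2 h1) (not_le.2 hβ.1)⟩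
  gamme := by
    refine ⟨h.majorScale, ⟨rfl, rfl⟩, ?_, Or.inl ⟨1, ?_⟩, ?_, ?_, h.majorScale_disjoint,
      h.majorScale_triad⟩
    · simp [Scale.Compatible, majorScale]
    · intro r hr
      rw [h.semitone_eq]
      simp only [majorScale, List.mem_cons, List.not_mem_nil, or_false] at hr
      rcases hr with rfl | rfl | rfl | rfl | rfl | rfl | rfl <;> norm_num
    · simp [Scale.AscSensible, majorScale, h.semitone_eq]
    · rw [Scale.DescSensible, h.semitone_eq]
      intro he
      have h2 : (ε ^ 2)⁻¹ = ε⁻¹ := by simpa [majorScale] using he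
      rw [inv_inj] at h2
      nlinarith [h.one_lt]

end IsTwelveTone

/-- The twelve-tone structure on the model of all timbres. -/
def ofTimbres (g₀ g₁ : Cp) : ToneInterpretation.{u} where
  toInterpretation := Cp.interpretation g₀ g₁
  equitonal x y := ∃ k : ℤ, Cp.soundPeriod y = 2 ^ k * Cp.soundPeriod x
  harmonic I := ∃ k : ℤ, Cp.pitchRatio I = ((2 : ℝ) ^ (1 / 12 : ℝ)) ^ k

lemma ofTimbres_isTwelveTone {g₀ g₁ : Cp} (h : g₁.period = 2 * g₀.period) :
    (ofTimbres.{u} g₀ g₁).IsTwelveTone ((2 : ℝ) ^ (1 / 12 : ℝ)) := by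
  have h0 := g₀.period_pos
  have hlt : g₀.period < g₁.period := by linarith
  have hf : ∀ x, (ofTimbres.{u} g₀ g₁).frequency x = Cp.soundPeriod x :=
    Cp.interpretation_frequency hlt
  refine ⟨Cp.interpretation_isModelPIStar hlt, ?_, Real.one_lt_rpow one_lt_two (by norm_num), ?_,
    fun x y => ?_, fun a b => ?_⟩
  · change g₁.period / g₀.period = 2
    rw [h, mul_div_cancel_right₀ _ h0.ne']
  · rw [← Real.rpow_natCast, ← Real.rpow_mul two_pos.le]
    norm_num
  · rw [hf, hf]
    rfl
  · rw [hf, hf]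
    refine exists_congr fun k => ?_
    rw [← div_eq_iff (Cp.soundPeriod_pos a).ne']
    rfl

end ToneInterpretation
end Music
end

theorem mainTheorem6 :
    -- the theory of pitch, intervals, loudness and colour with the timbre onto has a model
    (∀ lam f₀ i₀ : ℝ, 1 < lam → 0 < f₀ → 0 < i₀ →
      ∃ M : Music.Interpretation.{u}, M.IsModelPIStar ∧ M.lam = lam ∧ M.f₀ = f₀ ∧ M.i₀ = i₀) ∧
    -- any two models are isomorphic through the composite of the timbres
    (∀ (M₁ : Music.Interpretation.{v}) (M₂ : Music.Interpretation.{w})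
      (h₁ : M₁.IsModelPIStar) (h₂ : M₂.IsModelPIStar),
      Music.IsIso M₁ M₂ (h₁.timbreEquiv.trans h₂.timbreEquiv.symm)) ∧
    -- the same for the extension by tone music
    (∀ f₀ i₀ : ℝ, 0 < f₀ → 0 < i₀ →
      ∃ M : Music.ToneInterpretation.{u}, M.IsModelPITStar ∧ M.f₀ = f₀ ∧ M.i₀ = i₀) ∧
    (∀ (M₁ : Music.ToneInterpretation.{v}) (M₂ : Music.ToneInterpretation.{w})
      (h₁ : M₁.IsModelPITStar) (h₂ : M₂.IsModelPITStar),
      Music.IsToneIso M₁ M₂ (h₁.pi.timbreEquiv.trans h₂.pi.timbreEquiv.symm)) := by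
  refine ⟨fun lam f₀ i₀ hlam hf hi => ?_, fun M₁ M₂ => Music.Interpretation.isIso_timbreEquiv,
    fun f₀ i₀ hf hi => ?_, fun M₁ M₂ => Music.ToneInterpretation.isToneIso_timbreEquiv⟩
  -- The base timbre `g₀` carries the prescribed frequency and intensity as period and amplitude;
  -- only the period of `g₁` matters, so its amplitude is arbitrary.
  · obtain ⟨g₀, hg₀, hA⟩ := Music.Cp.exists_period_amplitude hf hi
    obtain ⟨g₁, hg₁, -⟩ :=
      Music.Cp.exists_period_amplitude (mul_pos (zero_lt_one.trans hlam) hf) hi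
    refine ⟨Music.Cp.interpretation g₀ g₁, Music.Cp.interpretation_isModelPIStar ?_, ?_, hg₀, hA⟩
    · rw [hg₀, hg₁]
      nlinarith
    · change g₁.period / g₀.period = lam
      rw [hg₀, hg₁, mul_div_cancel_right₀ _ hf.ne']
  · obtain ⟨g₀, hg₀, hA⟩ := Music.Cp.exists_period_amplitude hf hi
    obtain ⟨g₁, hg₁, -⟩ := Music.Cp.exists_period_amplitude (mul_pos two_pos hf) hi
    have h := Music.ToneInterpretation.ofTimbres_isTwelveTone (g₀ := g₀) (g₁ := g₁)
      (by rw [hg₀, hg₁])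
    exact ⟨Music.ToneInterpretation.ofTimbres g₀ g₁, ⟨h.pi, h.toneAxioms⟩, hg₀, hA⟩
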